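/- A partial function $F:\subseteq\mathbb{N}^{\mathbb{N}}\to\mathbb{N}^{\mathbb{N}}$ is computable if a single oracle machine computes $F(p)(n)$ from $n$ with oracle $p$, for all $p\in\operatorname{dom}(F)$ and $n\in\mathbb{N}$. A representation of a set $X$ is a surjective partial function $\delta_X:\subseteq\mathbb{N}^{\mathbb{N}}\to X$; if $\delta_X(p)=x$, then $p$ is called a name of $x$. A partial multi-valued function $f:\subseteq X\rightrightarrows Y$ between represented spaces is realized by $F:\subseteq\mathbb{N}^{\mathbb{N}}\to\mathbb{N}^{\mathbb{N}}$, written $F\vdash f$, if $F$ maps every name of every $x\in\operatorname{dom}(f)=\{x: f(x)\neq\emptyset\}$ to a name of some $y\in f(x)$. One writes $f\leq_{\mathrm{sW}}g$ if there are computable $H,K:\subseteq\mathbb{N}^{\mathbb{N}}\to\mathbb{N}^{\mathbb{N}}$ such that $K\circ G\circ H\vdash f$ whenever $G\vdash g$, and $f\equiv_{\mathrm{sW}}g$ (strong Weihrauch equivalence) if $f\leq_{\mathrm{sW}}g$ and $g\leq_{\mathrm{sW}}f$. Fix effective enumerations $\alpha$ of $\mathbb{Q}^n$ (one for each $n$)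 and $(q_m)_m$ of the nonnegative rationals, and a computable pairing function on $\mathbb{N}$. The space $\mathbb{R}^n$ carries the Euclidean metric $d$ and the Cauchy representation: $p$ is a name of $x$ if $d(\alpha(p(i)),\alpha(p(j)))\leq 2^{-i}$ for all $i\leq j$ and $\lim_i\alpha(p(i))=x$. The space $\mathcal{A}_+(\mathbb{R}^n)$ of closed subsets of $\mathbb{R}^n$ carries the positive information representation: a name of $A$ is an enumeration (possibly of the empty set) of exactly those $k=\langle j,m\rangle$ for which the open ball $B(\alpha(j),q_m)$ meets $A$. Finite products and sequence spaces carry the usual representations by pairing of names. Let - $\operatorname{Proj}^+_{\mathbb{R}^n}:\subseteq\mathbb{R}^n\times\mathcal{A}_+(\mathbb{R}^n)\rightrightarrows\mathbb{R}^n$ map $(x,A)$ with $A\neq\emptyset$ to the set of all $y\in A$ with $d(x,y)=\inf_{z\in A}d(x,z)$; - $\operatorname{BWT}_{\mathbb{R}}:\subseteq\mathbb{R}^{\mathbb{N}}\rightrightarrows\mathbb{R}$ map every bounded sequence (equivalently, every sequence whose range has compact closure) to the set of its cluster points. Then, for every $n\geq 2$, $$\operatorname{Proj}^+_{\mathbb{R}^n}\equiv_{\mathrm{sW}}\operatorname{BWT}_{\mathbb{R}}.$$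 -/

import Mathlib

open TopologicalSpace

noncomputable section

/-! ### Computability on Baire space -/

/-- Baire space `ℕ^ℕ`. -/
abbrev Baire : Type := ℕ → ℕ

/-- The partial recursive functionals: `Φ p n` is the result, if any, of running a fixed oracle
program on the number `n` with the infinite sequence `p` as oracle. This is `Nat.RecursiveIn`
uniformly in the oracle: one and the same program serves every `p`. -/
inductive RecursiveFunctional : (Baire → ℕ →. ℕ) → Prop
  | zero : RecursiveFunctional fun _ _ => Part.some 0
  | succ : RecursiveFunctional fun _ n => Part.some (n + 1)
  | left : RecursiveFunctional fun _ n => Part.some n.unpair.1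
  | right : RecursiveFunctional fun _ n => Part.some n.unpair.2
  | oracle : RecursiveFunctional fun p n => Part.some (p n)
  | pair {Φ Ψ : Baire → ℕ →. ℕ} (hΦ : RecursiveFunctional Φ) (hΨ : RecursiveFunctional Ψ) :
      RecursiveFunctional fun p n => Nat.pair <$> Φ p n <*> Ψ p n
  | comp {Φ Ψ : Baire → ℕ →. ℕ} (hΦ : RecursiveFunctional Φ) (hΨ : RecursiveFunctional Ψ) :
      RecursiveFunctional fun p n => Ψ p n >>= Φ p
  | prec {Φ Ψ : Baire → ℕ →. ℕ} (hΦ : RecursiveFunctional Φ) (hΨ : RecursiveFunctional Ψ) :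
      RecursiveFunctional fun p a =>
        let (a, n) := Nat.unpair a
        n.rec (Φ p a) fun y IH => do
          let i ← IH
          Ψ p (Nat.pair a (Nat.pair y i))
  | rfind {Φ : Baire → ℕ →. ℕ} (hΦ : RecursiveFunctional Φ) :
      RecursiveFunctional fun p a =>
        Nat.rfind fun n => (fun m => m = 0) <$> Φ p (Nat.pair a n)

/-- A partial function `F` on Baire space is computable if one oracle program computes, for every
`p` in the domain of `F`, each entry of the sequence `F p` from the entries of `p`. -/
def BaireComputable (F : Baire →. Baire) : Prop :=
  ∃ Φ : Baire → ℕ →. ℕ, RecursiveFunctional Φ ∧ ∀ p q, q ∈ F p → ∀ n, q n ∈ Φ p n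

/-! ### Represented spaces -/

/-- A representation of `X`: a surjective partial function from Baire space to `X`, given by its
graph; `Names p x` says that `p` is a name of `x`. -/
structure BaireRep (X : Type*) where
  Names : Baire → X → Prop
  unique : ∀ {p x y}, Names p x → Names p y → x = y
  surjective : ∀ x, ∃ p, Names p x

namespace BaireRep

/-- Representation of a product: the name of `(x, y)` has a name of `x` at its even places and a
name of `y` at its odd places. -/
def prod {X Y : Type*} (δ : BaireRep X) (ε : BaireRep Y) :
    BaireRep (X × Y) where
  Names r z := δ.Names (fun i => r (2 * i)) z.1 ∧ ε.Names (fun i => r (2 * i + 1)) z.2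
  unique h h' := Prod.ext (δ.unique h.1 h'.1) (ε.unique h.2 h'.2)
  surjective z := by
    obtain ⟨p, hp⟩ := δ.surjective z.1
    obtain ⟨q, hq⟩ := ε.surjective z.2
    refine ⟨fun k => if k % 2 = 0 then p (k / 2) else q (k / 2), ?_, ?_⟩
    · convert hp using 2 with i
      simp
    · convert hq using 2 with i
      have h1 : (2 * i + 1) % 2 = 1 := by omega
      have h2 : (2 * i + 1) / 2 = i := by omega
      simp [h1, h2]

/-- Representation of the sequences in `X`: a name of `(xᵢ)` is a sequence `⟨p₀, p₁, …⟩`, coded by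
the pairing function, of names `pᵢ` of `xᵢ`. -/
def seq {X : Type*} (δ : BaireRep X) : BaireRep (ℕ → X) where
  Names r s := ∀ i, δ.Names (fun j => r (Nat.pair i j)) (s i)
  unique h h' := funext fun i => δ.unique (h i) (h' i)
  surjective s := by
    choose p hp using fun i => δ.surjective (s i)
    exact ⟨fun k => p k.unpair.1 k.unpair.2, fun i => by simpa using hp i⟩

/-- The Cauchy representation of a metric space with respect to a dense sequence `α`. -/
def cauchy {X : Type*} [MetricSpace X] (α : ℕ → X) (hα : DenseRange α) : BaireRep X where
  Names p x := (∀ i j, i ≤ j → dist (α (p i)) (α (p j)) ≤ (2 : ℝ)⁻¹ ^ i) ∧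
    Filter.Tendsto (fun i => α (p i)) Filter.atTop (nhds x)
  unique h h' := tendsto_nhds_unique h.2 h'.2
  surjective x := by
    have hpos : ∀ i : ℕ, (0 : ℝ) < (2 : ℝ)⁻¹ ^ (i + 1) := fun i => by positivity
    choose p hp using fun i : ℕ => hα.exists_dist_lt x (hpos i)
    refine ⟨p, fun i j hij => ?_, ?_⟩
    · have hj : (2 : ℝ)⁻¹ ^ (j + 1) ≤ (2 : ℝ)⁻¹ ^ (i + 1) :=
        pow_le_pow_of_le_one (by norm_num) (by norm_num) (by omega)
      have h2 : (2 : ℝ)⁻¹ ^ (i + 1) = (2 : ℝ)⁻¹ ^ i / 2 := by rw [pow_succ]; ring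
      have := dist_triangle_left (α (p i)) (α (p j)) x
      linarith [hp i, hp j]
    · rw [tendsto_iff_dist_tendsto_zero]
      have h0 : Filter.Tendsto (fun i : ℕ => (2 : ℝ)⁻¹ ^ (i + 1)) Filter.atTop (nhds 0) :=
        (tendsto_pow_atTop_nhds_zero_of_lt_one (by norm_num) (by norm_num)).comp
          (Filter.tendsto_add_atTop_nat 1)
      refine squeeze_zero (fun _ => dist_nonneg) (fun i => ?_) h0
      rw [dist_comm]
      exact (hp i).le

end BaireRep

/-! ### Basic balls and positive information on closed sets -/

/-- An effective enumeration of the rational numbers. -/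
def ratEnum (k : ℕ) : ℚ :=
  (Equiv.intEquivNat.symm k.unpair.1 : ℚ) / ((k.unpair.2 : ℚ) + 1)

/-- An effective enumeration of the nonnegative rational numbers. -/
def nonnegRatEnum (m : ℕ) : ℚ :=
  (m.unpair.1 : ℚ) / ((m.unpair.2 : ℚ) + 1)

theorem ratEnum_surjective : Function.Surjective ratEnum := by
  intro q
  refine ⟨Nat.pair (Equiv.intEquivNat q.num) (q.den - 1), ?_⟩
  have h : ((q.den - 1 : ℕ) : ℚ) + 1 = q.den := by
    exact_mod_cast Nat.sub_add_cancel q.den_pos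
  simp only [ratEnum, Nat.unpair_pair, Equiv.symm_apply_apply, h]
  exact Rat.num_div_den q

theorem exists_nonnegRatEnum_between {r : ℝ} (hr : 0 < r) :
    ∃ m, 0 < (nonnegRatEnum m : ℝ) ∧ (nonnegRatEnum m : ℝ) < r := by
  obtain ⟨k, hk⟩ := exists_nat_one_div_lt hr
  refine ⟨Nat.pair 1 k, ?_, ?_⟩
  · simp only [nonnegRatEnum, Nat.unpair_pair]
    push_cast
    positivity
  · simpa [nonnegRatEnum] using hk

/-- The `k`-th basic open ball, `k = ⟨n, m⟩`: centre `α n`, radius the `m`-th nonnegative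
rational. -/
def basicBall {X : Type*} [MetricSpace X] (α : ℕ → X) (k : ℕ) : Set X :=
  Metric.ball (α k.unpair.1) (nonnegRatEnum k.unpair.2)

/-- The positive information representation of the closed subsets of `X`: `p` is a name of `A` if
it lists exactly the indices of the basic open balls that meet `A`. An entry `k + 1` lists the
index `k`, and an entry `0` lists nothing, so that the empty set has a name too. -/
def BaireRep.positive {X : Type*} [MetricSpace X] (α : ℕ → X) (hα : DenseRange α) :
    BaireRep (Closeds X) where
  Names p A := ∀ k, (∃ i, p i = k + 1) ↔ (basicBall α k ∩ (A : Set X)).Nonempty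
  unique {p A B} hA hB := by
    have key : ∀ A B : Closeds X,
        (∀ k, (basicBall α k ∩ (A : Set X)).Nonempty → (basicBall α k ∩ (B : Set X)).Nonempty) →
        (A : Set X) ⊆ B := by
      intro A B h x hx
      rw [← B.isClosed.closure_eq, Metric.mem_closure_iff]
      intro ε hε
      obtain ⟨m, hm0, hm⟩ := exists_nonnegRatEnum_between (half_pos hε)
      obtain ⟨n, hn⟩ := hα.exists_dist_lt x hm0
      obtain ⟨b, hb, hbB⟩ := h (Nat.pair n m) ⟨x, by simpa [basicBall] using hn, hx⟩
      have hb' : dist b (α n) < nonnegRatEnum m := by simpa [basicBall] using hb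
      refine ⟨b, hbB, ?_⟩
      have := dist_triangle_right x b (α n)
      linarith
    exact SetLike.coe_injective (Set.Subset.antisymm
      (key A B fun k h => (hB k).1 ((hA k).2 h)) (key B A fun k h => (hA k).1 ((hB k).2 h)))
  surjective A := by
    classical
    refine ⟨fun i => if (basicBall α i ∩ (A : Set X)).Nonempty then i + 1 else 0, fun k => ?_⟩
    constructor
    · rintro ⟨i, hi⟩
      dsimp only at hi
      split_ifs at hi with h
      · obtain rfl : i = k := by omega
        exact h
    · intro h
      exact ⟨k, if_pos h⟩

/-! ### The Euclidean spaces -/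

/-- An effective enumeration of `ℚⁿ` in `ℝⁿ`: `k` codes a list of natural numbers, whose `i`-th
entry (`0` if there is none) is the index, in `ratEnum`, of the `i`-th coordinate. -/
def ratVecEnum (n k : ℕ) : EuclideanSpace ℝ (Fin n) :=
  WithLp.toLp 2 fun i => (ratEnum ((Denumerable.ofNat (List ℕ) k).getD i 0) : ℝ)

theorem denseRange_ratEnum : DenseRange fun k => (ratEnum k : ℝ) :=
  Rat.denseRange_cast.comp ratEnum_surjective.denseRange Rat.continuous_coe_real

theorem denseRange_ratVecEnum (n : ℕ) : DenseRange (ratVecEnum n) := by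
  have h1 : DenseRange fun v : Fin n → ℚ => fun i => (v i : ℝ) :=
    DenseRange.piMap fun _ => Rat.denseRange_cast
  have h2 : DenseRange fun v : Fin n → ℚ =>
      (WithLp.toLp 2 fun i => (v i : ℝ) : EuclideanSpace ℝ (Fin n)) :=
    (WithLp.toLp_surjective 2).denseRange.comp h1 (PiLp.continuous_toLp 2 _)
  refine h2.mono ?_
  rintro _ ⟨v, rfl⟩
  choose c hc using fun i => ratEnum_surjective (v i)
  refine ⟨Encodable.encode (List.ofFn c), ?_⟩
  simp [ratVecEnum, hc]

/-- The Cauchy representation of `ℝ`. -/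
def realRep : BaireRep ℝ :=
  BaireRep.cauchy (fun k => (ratEnum k : ℝ)) denseRange_ratEnum

/-- The Cauchy representation of `ℝⁿ` with the Euclidean metric. -/
def euclideanRep (n : ℕ) : BaireRep (EuclideanSpace ℝ (Fin n)) :=
  BaireRep.cauchy (ratVecEnum n) (denseRange_ratVecEnum n)

/-- The closed subsets of `ℝⁿ` with positive information. -/
def euclideanPosRep (n : ℕ) : BaireRep (Closeds (EuclideanSpace ℝ (Fin n))) :=
  BaireRep.positive (ratVecEnum n) (denseRange_ratVecEnum n)

/-! ### Multi-valued functions and strong Weihrauch reducibility -/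

/-- A partial multi-valued function between represented spaces. Its domain consists of the `x`
with `values x` nonempty. -/
structure MultiFunction (X Y : Type*) where
  source : BaireRep X
  target : BaireRep Y
  values : X → Set Y

namespace MultiFunction

/-- The domain of a partial multi-valued function. -/
def dom {X Y : Type*} (f : MultiFunction X Y) : Set X :=
  {x | (f.values x).Nonempty}

/-- `F` realizes `f`: it maps every name of every `x` in the domain of `f` to a name of some
element of `f x`. -/
def Realizes {X Y : Type*} (F : Baire →. Baire) (f : MultiFunction X Y) : Prop :=
  ∀ p x, f.source.Names p x → x ∈ f.dom →
    ∃ q ∈ F p, ∃ y ∈ f.values x, f.target.Names q y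

/-- Strong Weihrauch reducibility: there are computable `H` and `K` such that `K ∘ G ∘ H` realizes
`f` for every realizer `G` of `g`. -/
def StrongReducible {X Y Z W : Type*} (f : MultiFunction X Y) (g : MultiFunction Z W) : Prop :=
  ∃ H K : Baire →. Baire, BaireComputable H ∧ BaireComputable K ∧
    ∀ G : Baire →. Baire, Realizes G g → Realizes (K.comp (G.comp H)) f

/-- Strong Weihrauch equivalence. -/
def StrongEquiv {X Y Z W : Type*} (f : MultiFunction X Y) (g : MultiFunction Z W) : Prop :=
  StrongReducible f g ∧ StrongReducible g f

end MultiFunction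

/-- The exact positive projection operator on `ℝⁿ`: it maps a point `x` and a nonempty closed set
`A`, given by positive information, to the points of `A` at minimal distance from `x`. -/
def projPos (n : ℕ) :
    MultiFunction (EuclideanSpace ℝ (Fin n) × Closeds (EuclideanSpace ℝ (Fin n)))
      (EuclideanSpace ℝ (Fin n)) where
  source := (euclideanRep n).prod (euclideanPosRep n)
  target := euclideanRep n
  values z := {y | y ∈ z.2 ∧ dist z.1 y = Metric.infDist z.1 (z.2 : Set _)}

/-- The Bolzano-Weierstraß operator on `ℝ`: it maps a sequence whose range is relatively compact,
that is, a bounded sequence, to its cluster points. -/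
def bwtReal : MultiFunction (ℕ → ℝ) ℝ where
  source := realRep.seq
  target := realRep
  values a := {y | IsCompact (closure (Set.range a)) ∧ MapClusterPt y Filter.atTop a}

end

/-!
A rational ball of radius `r` whose centre is at distance `d` from `x` is weighed by
`(1 + r) (1 + r + d ^ 2)`. Among the balls meeting `A`, the weights have infimum
`1 + dist(x, A) ^ 2`, and a ball exceeds it by at least its radius. Hence, if the `s`-th ball is
the lightest one among the first `s` balls listed by a name of `A`, every cluster point of the
centres lies in `A` and is nearest to `x`, so a projection is found by the Bolzano-Weierstraß
operator of `ℝⁿ`. That operator is reduced to the one of Baire space, because the points of a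
compact set have names with bounded entries, and a cluster point of such names is a name of a
cluster point. Finally, Baire space is coded in the real line by nested intervals separated by
gaps, so that a cluster point of the codes of longer and longer prefixes can be decoded.

Conversely, given a bounded sequence `t` of reals, let `c` be the rational parametrization of the
unit circle by the slope seen from `(-1, 0)`. The points `(1 + 2⁻ˢ) c(tₛ)` approach the circle from
outside, so the points of the closure of their set that are nearest to the origin are the `c(T)`
with `T` a cluster point of `t`, and `T` is computable from `c(T) = (x, y)` as `y / (1 + x)`.
-/

open Filter Topology

/-! ### Recursive functionals and reductions -/

namespace RecursiveFunctional

theorem of_eq {Φ Ψ : Baire → ℕ →. ℕ} (h : RecursiveFunctional Φ) (e : ∀ p n, Φ p n = Ψ p n) :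
    RecursiveFunctional Ψ :=
  (funext fun p => funext (e p) : Φ = Ψ) ▸ h

theorem of_partrec {f : ℕ →. ℕ} (hf : Nat.Partrec f) : RecursiveFunctional fun _ => f := by
  induction hf with
  | zero => exact zero
  | succ => exact succ
  | left => exact left
  | right => exact right
  | pair _ _ hf hg => exact pair hf hg
  | comp _ _ hf hg => exact comp hf hg
  | prec _ _ hf hg => exact prec hf hg
  | rfind _ hf => exact rfind hf

theorem of_computable {f : ℕ → ℕ} (hf : Computable f) :
    RecursiveFunctional fun _ n => Part.some (f n) :=
  of_partrec (Partrec.nat_iff.1 hf)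

theorem query {b : ℕ → ℕ} (hb : Computable b) {f : ℕ → ℕ → ℕ} (hf : Computable₂ f) :
    RecursiveFunctional fun p n => Part.some (f n (p (b n))) := by
  have hf' : Computable fun v : ℕ => f v.unpair.1 v.unpair.2 :=
    hf.comp (Computable.fst.comp .unpair) (Computable.snd.comp .unpair)
  refine (comp (of_computable hf')
    (pair (of_computable Computable.id) (comp oracle (of_computable hb)))).of_eq fun p n => ?_
  simp [Seq.seq]

theorem initialSegment :
    RecursiveFunctional fun p n => Part.some (Encodable.encode ((List.range n).map p)) := by
  have hstep : Computable₂ fun v a : ℕ =>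
      Encodable.encode (Denumerable.ofNat (List ℕ) v.unpair.2.unpair.2 ++ [a]) :=
    Computable.encode.comp (Computable.list_concat.comp
      ((Computable.ofNat (List ℕ)).comp (Computable.snd.comp (Computable.unpair.comp
        (Computable.snd.comp (Computable.unpair.comp Computable.fst))))) Computable.snd)
  have hindex : Computable fun v : ℕ => v.unpair.2.unpair.1 :=
    Computable.fst.comp (Computable.unpair.comp (Computable.snd.comp Computable.unpair))
  refine (comp (prec (of_computable (Computable.const (Encodable.encode ([] : List ℕ))))
    (query hindex hstep)) (pair zero (of_computable Computable.id))).of_eq fun p n => ?_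
  simp only [Seq.seq, Part.map_eq_map, Part.map_some, Part.bind_some, id, Part.bind_eq_bind,
    Nat.unpair_pair]
  induction n with
  | zero => simp
  | succ n ih =>
    dsimp only
    rw [ih]
    simp [List.range_succ]

theorem of_initialSegment {b : ℕ → ℕ} (hb : Computable b) {f : List ℕ → ℕ → ℕ}
    (hf : Computable₂ f) :
    RecursiveFunctional fun p n => Part.some (f ((List.range (b n)).map p) n) := by
  have hf' : Computable fun v : ℕ => f (Denumerable.ofNat (List ℕ) v.unpair.1) v.unpair.2 :=
    hf.comp ((Computable.ofNat _).comp (Computable.fst.comp .unpair))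
      (Computable.snd.comp .unpair)
  refine (comp (of_computable hf') (pair (comp initialSegment (of_computable hb))
    (of_computable Computable.id))).of_eq fun p n => ?_
  simp only [Seq.seq, Part.map_eq_map, Part.map_some, Part.bind_some, Part.bind_eq_bind, id,
    Nat.unpair_pair, Denumerable.ofNat_encode]

theorem of_modulus {b : ℕ → ℕ} (hb : Computable b) {F : Baire → ℕ → ℕ}
    (hF : Computable₂ fun (l : List ℕ) n => F (fun i => l.getD i 0) n)
    (hmod : ∀ p q n, (∀ i < b n, p i = q i) → F p n = F q n) :
    RecursiveFunctional fun p n => Part.some (F p n) :=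
  (of_initialSegment hb hF).of_eq fun p n =>
    congrArg Part.some (hmod _ _ _ fun i hi => by simp [hi])

theorem exists_search {b : ℕ → ℕ} (hb : Computable b) {R : ℕ → ℕ → ℕ → Prop}
    (hR : PrimrecPred fun v : ℕ × ℕ × ℕ => R v.1 v.2.1 v.2.2) {g : ℕ × ℕ × ℕ → ℕ}
    (hg : Computable g) :
    ∃ Φ, RecursiveFunctional Φ ∧ ∀ p n, (∃ w, R n w (p (b w))) →
      ∃ w, R n w (p (b w)) ∧ g (n, w, p (b w)) ∈ Φ p n := by
  classical
  obtain ⟨test, htest, hcorrect⟩ : ∃ test : ℕ → ℕ → ℕ, Computable₂ test ∧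
      ∀ n w a, test (Nat.pair n w) a = 0 ↔ R n w a := by
    refine ⟨fun v a => if R v.unpair.1 v.unpair.2 a then 0 else 1, ?_, by simp⟩
    refine (Primrec.ite (PrimrecPred.comp (f := fun v : ℕ × ℕ => (v.1.unpair.1, v.1.unpair.2, v.2))
      hR ?_) (.const 0) (.const 1)).to_comp
    have hunpair : Primrec fun v : ℕ × ℕ => v.1.unpair := Primrec.unpair.comp .fst
    exact (Primrec.fst.comp hunpair).pair ((Primrec.snd.comp hunpair).pair .snd)
  have houtput : Computable₂ fun v a : ℕ => g (v.unpair.1, v.unpair.2, a) := by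
    have hunpair : Computable fun v : ℕ × ℕ => v.1.unpair := Computable.unpair.comp .fst
    exact hg.comp ((Computable.fst.comp hunpair).pair ((Computable.snd.comp hunpair).pair .snd))
  have hquery : Computable fun v : ℕ => b v.unpair.2 :=
    hb.comp (Computable.snd.comp .unpair)
  refine ⟨_, comp (query hquery houtput)
    (pair (of_computable Computable.id) (rfind (query hquery htest))), fun p n hex => ?_⟩
  have hdom : ∃ w, test (Nat.pair n w) (p (b (Nat.pair n w).unpair.2)) = 0 :=
    hex.imp fun w hw => by simpa [hcorrect] using hw
  refine ⟨Nat.find hdom, by simpa [hcorrect] using Nat.find_spec hdom, ?_⟩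
  have hfind : Nat.find hdom ∈ Nat.rfind fun w => (fun m : ℕ => (decide (m = 0) : Bool)) <$>
      Part.some (test (Nat.pair n w) (p (b (Nat.pair n w).unpair.2))) := by
    refine Nat.mem_rfind.2 ⟨?_, fun {w} hw => ?_⟩
    · simpa using Nat.find_spec hdom
    · simpa using Nat.find_min hdom hw
  refine Part.mem_bind_iff.2 ⟨Nat.pair n (Nat.find hdom), ?_, by simp⟩
  simpa [Seq.seq] using hfind

theorem exists_subst {Φ Ψ : Baire → ℕ →. ℕ} (hΨ : RecursiveFunctional Ψ)
    (hΦ : RecursiveFunctional Φ) :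
    ∃ Θ, RecursiveFunctional Θ ∧ ∀ p q, (∀ n, q n ∈ Φ p n) → Θ p = Ψ q := by
  induction hΨ with
  | zero => exact ⟨_, zero, fun _ _ _ => rfl⟩
  | succ => exact ⟨_, succ, fun _ _ _ => rfl⟩
  | left => exact ⟨_, left, fun _ _ _ => rfl⟩
  | right => exact ⟨_, right, fun _ _ _ => rfl⟩
  | oracle => exact ⟨Φ, hΦ, fun p q h => funext fun n => Part.eq_some_iff.2 (h n)⟩
  | pair _ _ ih₁ ih₂ =>
    obtain ⟨Θ₁, hΘ₁, e₁⟩ := ih₁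
    obtain ⟨Θ₂, hΘ₂, e₂⟩ := ih₂
    exact ⟨_, pair hΘ₁ hΘ₂, fun p q h => funext fun _ => by simp only [e₁ p q h, e₂ p q h]⟩
  | comp _ _ ih₁ ih₂ =>
    obtain ⟨Θ₁, hΘ₁, e₁⟩ := ih₁
    obtain ⟨Θ₂, hΘ₂, e₂⟩ := ih₂
    exact ⟨_, comp hΘ₁ hΘ₂, fun p q h => funext fun _ => by simp only [e₁ p q h, e₂ p q h]⟩
  | prec _ _ ih₁ ih₂ =>
    obtain ⟨Θ₁, hΘ₁, e₁⟩ := ih₁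
    obtain ⟨Θ₂, hΘ₂, e₂⟩ := ih₂
    exact ⟨_, prec hΘ₁ hΘ₂, fun p q h => funext fun _ => by simp only [e₁ p q h, e₂ p q h]⟩
  | rfind _ ih =>
    obtain ⟨Θ, hΘ, e⟩ := ih
    exact ⟨_, rfind hΘ, fun p q h => funext fun _ => by simp only [e p q h]⟩

end RecursiveFunctional

theorem BaireComputable.comp {F G : Baire →. Baire} (hF : BaireComputable F)
    (hG : BaireComputable G) : BaireComputable (F.comp G) := by
  obtain ⟨Φ, hΦ, hΦF⟩ := hF
  obtain ⟨Ψ, hΨ, hΨG⟩ := hG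
  obtain ⟨Θ, hΘ, hsubst⟩ := hΦ.exists_subst hΨ
  refine ⟨Θ, hΘ, fun p q hq n => ?_⟩
  obtain ⟨r, hr, hqr⟩ := Part.mem_bind_iff.1 hq
  rw [hsubst p r (hΨG p r hr)]
  exact hΦF r q hqr n

/-- The partial function on Baire space computed by a functional. -/
def functionalToBaire (Φ : Baire → ℕ →. ℕ) : Baire →. Baire :=
  fun p => ⟨∀ n, (Φ p n).Dom, fun h n => (Φ p n).get (h n)⟩

theorem mem_functionalToBaire {Φ : Baire → ℕ →. ℕ} {p q : Baire} :
    q ∈ functionalToBaire Φ p ↔ ∀ n, q n ∈ Φ p n := by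
  constructor
  · rintro ⟨h, rfl⟩ n
    exact ⟨h n, rfl⟩
  · intro h
    exact ⟨fun n => (h n).1, funext fun n => (h n).2⟩

theorem RecursiveFunctional.baireComputable {Φ : Baire → ℕ →. ℕ} (h : RecursiveFunctional Φ) :
    BaireComputable (functionalToBaire Φ) :=
  ⟨Φ, h, fun _ _ hq => mem_functionalToBaire.1 hq⟩

namespace MultiFunction.StrongReducible

theorem trans {X₁ Y₁ X₂ Y₂ X₃ Y₃ : Type*} {f : MultiFunction X₁ Y₁} {g : MultiFunction X₂ Y₂}
    {h : MultiFunction X₃ Y₃} (hfg : StrongReducible f g) (hgh : StrongReducible g h) :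
    StrongReducible f h := by
  obtain ⟨H₁, K₁, hH₁, hK₁, hG₁⟩ := hfg
  obtain ⟨H₂, K₂, hH₂, hK₂, hG₂⟩ := hgh
  refine ⟨H₂.comp H₁, K₁.comp K₂, hH₂.comp hH₁, hK₁.comp hK₂, fun G hG => ?_⟩
  simpa only [PFun.comp_assoc] using hG₁ _ (hG₂ G hG)

theorem of_functional {X Y Z W : Type*} {f : MultiFunction X Y} {g : MultiFunction Z W}
    {H : Baire → ℕ → ℕ} {Ψ : Baire → ℕ →. ℕ}
    (hH : RecursiveFunctional fun p n => Part.some (H p n)) (hΨ : RecursiveFunctional Ψ)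
    (hfg : ∀ p x, f.source.Names p x → x ∈ f.dom →
      ∃ z ∈ g.dom, g.source.Names (H p) z ∧
        ∀ w ∈ g.values z, ∀ r, g.target.Names r w →
          ∃ q y, (∀ n, q n ∈ Ψ r n) ∧ y ∈ f.values x ∧ f.target.Names q y) :
    StrongReducible f g := by
  refine ⟨_, _, hH.baireComputable, hΨ.baireComputable, fun G hG p x hp hx => ?_⟩
  obtain ⟨z, hz, hpz, hw⟩ := hfg p x hp hx
  obtain ⟨r, hr, w, hwz, hrw⟩ := hG _ _ hpz hz
  obtain ⟨q, y, hq, hy, hqy⟩ := hw w hwz r hrw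
  have hHp : H p ∈ functionalToBaire (fun p n => Part.some (H p n)) p :=
    mem_functionalToBaire.2 fun _ => Part.mem_some _
  exact ⟨q, Part.mem_bind_iff.2 ⟨r, Part.mem_bind_iff.2 ⟨H p, hHp, hr⟩,
    mem_functionalToBaire.2 hq⟩, y, hy, hqy⟩

end MultiFunction.StrongReducible

/-! ### Primitive recursive rational-valued functions -/

theorem intEquivNat_symm_two_mul (a : ℕ) : Equiv.intEquivNat.symm (2 * a) = (a : ℤ) := by
  rw [Equiv.symm_apply_eq]
  rfl

theorem intEquivNat_symm_two_mul_add_one (a : ℕ) :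
    Equiv.intEquivNat.symm (2 * a + 1) = -((a : ℤ) + 1) := by
  rw [Equiv.symm_apply_eq, ← Int.negSucc_eq]
  simp [Equiv.intEquivNat, Equiv.intEquivNatSumNat]

theorem exists_primrec_intEquivNat_symm_eq_sub :
    ∃ a b : ℕ → ℕ, Primrec a ∧ Primrec b ∧ ∀ c, Equiv.intEquivNat.symm c = (a c : ℤ) - b c := by
  have heven : PrimrecPred fun c : ℕ => c % 2 = 0 :=
    Primrec.eq.comp (Primrec.nat_mod.comp .id (.const 2)) (.const 0)
  have hhalf : Primrec fun c : ℕ => c / 2 := Primrec.nat_div.comp .id (.const 2)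
  refine ⟨_, _, .ite heven hhalf (.const 0), .ite heven (.const 0) (Primrec.succ.comp hhalf),
    fun c => ?_⟩
  obtain ⟨a, rfl | rfl⟩ := Nat.even_or_odd' c
  · simp [intEquivNat_symm_two_mul]
  · rw [intEquivNat_symm_two_mul_add_one, if_neg (by omega), if_neg (by omega)]
    omega

theorem exists_primrec₂_intEquivNat_symm_eq_sub :
    ∃ c : ℕ → ℕ → ℕ, Primrec₂ c ∧ ∀ a b, Equiv.intEquivNat.symm (c a b) = (a : ℤ) - b := by
  refine ⟨fun a b => if b ≤ a then 2 * (a - b) else 2 * (b - a - 1) + 1,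
    Primrec.ite (Primrec.nat_le.comp .snd .fst)
      (Primrec.nat_double.comp (Primrec.nat_sub.comp .fst .snd))
      (Primrec.nat_double_succ.comp
        (Primrec.nat_sub.comp (Primrec.nat_sub.comp .snd .fst) (.const 1))), fun a b => ?_⟩
  dsimp only
  split_ifs with h
  · rw [intEquivNat_symm_two_mul]
    omega
  · rw [intEquivNat_symm_two_mul_add_one]
    omega

/-- A rational-valued function is primitive recursive if an index of its value with respect to
`ratEnum` can be computed primitive recursively. -/
def PrimrecRat {α : Type*} [Primcodable α] (f : α → ℚ) : Prop :=
  ∃ k : α → ℕ, Primrec k ∧ ∀ v, ratEnum (k v) = f v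

namespace PrimrecRat

section Arithmetic

variable {α β : Type*} [Primcodable α] [Primcodable β] {f g : α → ℚ}

theorem of_fraction {a b d : α → ℕ} (ha : Primrec a) (hb : Primrec b) (hd : Primrec d) :
    PrimrecRat fun v => ((a v : ℚ) - b v) / (d v + 1) := by
  obtain ⟨c, hc, hcsub⟩ := exists_primrec₂_intEquivNat_symm_eq_sub
  refine ⟨fun v => Nat.pair (c (a v) (b v)) (d v), Primrec₂.natPair.comp (hc.comp ha hb) hd,
    fun v => ?_⟩
  simp [ratEnum, hcsub]

theorem exists_fraction (hf : PrimrecRat f) :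
    ∃ a b d : α → ℕ, Primrec a ∧ Primrec b ∧ Primrec d ∧
      ∀ v, f v = ((a v : ℚ) - b v) / (d v + 1) := by
  obtain ⟨k, hk, hkf⟩ := hf
  obtain ⟨a, b, ha, hb, hab⟩ := exists_primrec_intEquivNat_symm_eq_sub
  have hnum : Primrec fun v => (k v).unpair.1 := Primrec.fst.comp (Primrec.unpair.comp hk)
  refine ⟨_, _, _, ha.comp hnum, hb.comp hnum, Primrec.snd.comp (Primrec.unpair.comp hk),
    fun v => ?_⟩
  rw [← hkf, ratEnum, hab]
  push_cast
  rfl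

theorem of_eq (hf : PrimrecRat f) (h : ∀ v, f v = g v) : PrimrecRat g :=
  (funext h : f = g) ▸ hf

theorem comp (hf : PrimrecRat f) {h : β → α} (hh : Primrec h) : PrimrecRat fun v => f (h v) := by
  obtain ⟨k, hk, hkf⟩ := hf
  exact ⟨_, hk.comp hh, fun v => hkf (h v)⟩

theorem ratEnum {k : α → ℕ} (hk : Primrec k) : PrimrecRat fun v => ratEnum (k v) :=
  ⟨k, hk, fun _ => rfl⟩

theorem const (q : ℚ) : PrimrecRat fun _ : α => q := by
  obtain ⟨k, hk⟩ := ratEnum_surjective q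
  exact ⟨_, .const k, fun _ => hk⟩

theorem natCast {k : α → ℕ} (hk : Primrec k) : PrimrecRat fun v => (k v : ℚ) :=
  (of_fraction hk (.const 0) (.const 0)).of_eq fun v => by simp

theorem nonnegRatEnum {m : α → ℕ} (hm : Primrec m) :
    PrimrecRat fun v => nonnegRatEnum (m v) :=
  (of_fraction (Primrec.fst.comp (Primrec.unpair.comp hm)) (.const 0)
    (Primrec.snd.comp (Primrec.unpair.comp hm))).of_eq fun v => by simp [_root_.nonnegRatEnum]

theorem add (hf : PrimrecRat f) (hg : PrimrecRat g) : PrimrecRat fun v => f v + g v := by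
  obtain ⟨a, b, d, ha, hb, hd, hf⟩ := hf.exists_fraction
  obtain ⟨a', b', d', ha', hb', hd', hg⟩ := hg.exists_fraction
  have hden : Primrec fun v => (d v + 1) * d' v + d v :=
    Primrec.nat_add.comp (Primrec.nat_mul.comp (Primrec.succ.comp hd) hd') hd
  have hnum {a a' : α → ℕ} (ha : Primrec a) (ha' : Primrec a') :
      Primrec fun v => a v * (d' v + 1) + a' v * (d v + 1) :=
    Primrec.nat_add.comp (Primrec.nat_mul.comp ha (Primrec.succ.comp hd'))
      (Primrec.nat_mul.comp ha' (Primrec.succ.comp hd))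
  refine (of_fraction (hnum ha ha') (hnum hb hb') hden).of_eq fun v => ?_
  have hsplit : ((((d v + 1) * d' v + d v : ℕ) : ℚ) + 1) = (d v + 1) * (d' v + 1) := by
    push_cast; ring
  rw [hf, hg, hsplit]
  push_cast
  field_simp
  ring

theorem mul (hf : PrimrecRat f) (hg : PrimrecRat g) : PrimrecRat fun v => f v * g v := by
  obtain ⟨a, b, d, ha, hb, hd, hf⟩ := hf.exists_fraction
  obtain ⟨a', b', d', ha', hb', hd', hg⟩ := hg.exists_fraction
  have hden : Primrec fun v => (d v + 1) * d' v + d v :=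
    Primrec.nat_add.comp (Primrec.nat_mul.comp (Primrec.succ.comp hd) hd') hd
  have hnum {a b : α → ℕ} (ha : Primrec a) (hb : Primrec b) :
      Primrec fun v => a v * a' v + b v * b' v :=
    Primrec.nat_add.comp (Primrec.nat_mul.comp ha ha') (Primrec.nat_mul.comp hb hb')
  refine (of_fraction (hnum ha hb) (hnum hb ha) hden).of_eq fun v => ?_
  have hsplit : ((((d v + 1) * d' v + d v : ℕ) : ℚ) + 1) = (d v + 1) * (d' v + 1) := by
    push_cast; ring
  rw [hf, hg, hsplit]
  push_cast
  field_simp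
  ring

theorem neg (hf : PrimrecRat f) : PrimrecRat fun v => -f v :=
  ((const (-1)).mul hf).of_eq fun v => by ring

theorem sub (hf : PrimrecRat f) (hg : PrimrecRat g) : PrimrecRat fun v => f v - g v :=
  (hf.add hg.neg).of_eq fun v => by ring

theorem sq (hf : PrimrecRat f) : PrimrecRat fun v => f v ^ 2 :=
  (hf.mul hf).of_eq fun v => by ring

theorem sum {ι : Type*} (s : Finset ι) {f : ι → α → ℚ} (hf : ∀ i, PrimrecRat (f i)) :
    PrimrecRat fun v => ∑ i ∈ s, f i v := by
  classical
  induction s using Finset.induction_on with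
  | empty => simpa using const 0
  | insert i s hi ih => simpa only [Finset.sum_insert hi] using (hf i).add ih

theorem lt (hf : PrimrecRat f) (hg : PrimrecRat g) : PrimrecPred fun v => f v < g v := by
  obtain ⟨a, b, d, ha, hb, hd, hf⟩ := hf.exists_fraction
  obtain ⟨a', b', d', ha', hb', hd', hg⟩ := hg.exists_fraction
  have hcross {a b d' d : α → ℕ} (ha : Primrec a) (hb : Primrec b) (hd' : Primrec d')
      (hd : Primrec d) : Primrec fun v => a v * (d' v + 1) + b v * (d v + 1) :=
    Primrec.nat_add.comp (Primrec.nat_mul.comp ha (Primrec.succ.comp hd'))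
      (Primrec.nat_mul.comp hb (Primrec.succ.comp hd))
  refine (Primrec.nat_lt.comp (hcross ha hb' hd' hd) (hcross ha' hb hd hd')).of_eq fun v => ?_
  rw [hf, hg, div_lt_div_iff₀ (by positivity) (by positivity), ← Nat.cast_lt (α := ℚ)]
  push_cast
  constructor <;> intro h <;> linarith

theorem le (hf : PrimrecRat f) (hg : PrimrecRat g) : PrimrecPred fun v => f v ≤ g v :=
  (hg.lt hf).not.of_eq fun _ => not_lt

theorem ite {c : α → Prop} [DecidablePred c] (hc : PrimrecPred c) (hf : PrimrecRat f)
    (hg : PrimrecRat g) : PrimrecRat fun v => if c v then f v else g v := by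
  obtain ⟨k, hk, hkf⟩ := hf
  obtain ⟨l, hl, hlg⟩ := hg
  exact ⟨_, .ite hc hk hl, fun v => by rw [apply_ite _root_.ratEnum, hkf, hlg]⟩

theorem abs (hf : PrimrecRat f) : PrimrecRat fun v => |f v| :=
  (ite ((const 0).le hf) hf hf.neg).of_eq fun v => by
    split_ifs with h
    · exact (abs_of_nonneg h).symm
    · exact (abs_of_neg (not_le.1 h)).symm

theorem inv (hf : PrimrecRat f) : PrimrecRat fun v => (f v)⁻¹ := by
  obtain ⟨a, b, d, ha, hb, hd, hfrac⟩ := hf.exists_fraction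
  have hlt := Primrec.nat_lt.comp hb ha
  have hgt := Primrec.nat_lt.comp ha hb
  -- `a - b + (b - a) - 1`, with truncated subtractions, is the integer `|a - b| - 1`.
  have hden : Primrec fun v => a v - b v + (b v - a v) - 1 :=
    Primrec.pred.comp (Primrec.nat_add.comp (Primrec.nat_sub.comp ha hb)
      (Primrec.nat_sub.comp hb ha))
  refine (of_fraction (.ite hlt (Primrec.succ.comp hd) (.const 0))
    (.ite hgt (Primrec.succ.comp hd) (.const 0)) hden).of_eq fun v => ?_
  rw [hfrac, inv_div]
  rcases lt_trichotomy (a v) (b v) with h | h | h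
  · obtain ⟨c, hc⟩ := Nat.exists_eq_add_of_lt h
    have hc' : a v - b v + (b v - a v) - 1 = c := by omega
    rw [if_neg h.not_gt, if_pos h, hc', hc]
    push_cast
    rw [show (a v : ℚ) - (a v + c + 1) = -(c + 1) by ring, div_neg, zero_sub, neg_div]
  · simp [h]
  · obtain ⟨c, hc⟩ := Nat.exists_eq_add_of_lt h
    have hc' : a v - b v + (b v - a v) - 1 = c := by omega
    rw [if_pos h, if_neg h.not_gt, hc', hc]
    push_cast
    rw [show (b v : ℚ) + c + 1 - b v = c + 1 by ring, sub_zero]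

theorem div (hf : PrimrecRat f) (hg : PrimrecRat g) : PrimrecRat fun v => f v / g v :=
  (hf.mul hg.inv).of_eq fun _ => (div_eq_mul_inv _ _).symm

theorem invPow (b : ℕ) {k : α → ℕ} (hk : Primrec k) : PrimrecRat fun v => (b : ℚ)⁻¹ ^ k v :=
  (natCast ((Primrec₂.unpaired'.1 Nat.Primrec.pow).comp (.const b) hk)).inv.of_eq
    fun _ => by simp

end Arithmetic

theorem list_foldr {F : ℕ → ℚ → ℚ} (hF : PrimrecRat fun v : ℕ × ℕ => F v.1 (_root_.ratEnum v.2))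
    (q : ℚ) : PrimrecRat fun l : List ℕ => l.foldr F q := by
  obtain ⟨k, hk, hkF⟩ := hF
  obtain ⟨j, rfl⟩ := ratEnum_surjective q
  refine ⟨fun l => l.foldr (fun a b => k (a, b)) j,
    Primrec.list_foldr .id (.const j) (hk.comp .snd), fun l => ?_⟩
  induction l with
  | nil => rfl
  | cons a l ih => simp only [List.foldr_cons, hkF, ih]

end PrimrecRat

theorem exists_primrecRat_eq_ratVecEnum_apply {n : ℕ} (i : Fin n) :
    ∃ c : ℕ → ℚ, PrimrecRat c ∧ ∀ k, ratVecEnum n k i = c k :=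
  ⟨_, .ratEnum ((Primrec.list_getD 0).comp (Primrec.ofNat (List ℕ)) (.const (i : ℕ))),
    fun _ => rfl⟩

theorem exists_primrecRat_eq_dist_ratVecEnum_sq {α : Type*} [Primcodable α] (n : ℕ) {j k : α → ℕ}
    (hj : Primrec j) (hk : Primrec k) :
    ∃ f : α → ℚ, PrimrecRat f ∧
      ∀ v, (f v : ℝ) = dist (ratVecEnum n (j v)) (ratVecEnum n (k v)) ^ 2 := by
  choose c hc hcoord using @exists_primrecRat_eq_ratVecEnum_apply n
  refine ⟨_, .sum Finset.univ fun i => (((hc i).comp hj).sub ((hc i).comp hk)).sq, fun v => ?_⟩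
  rw [EuclideanSpace.dist_sq_eq]
  push_cast
  exact Finset.sum_congr rfl fun i _ => by rw [hcoord, hcoord, Real.dist_eq, sq_abs]

theorem primrecPred_dist_ratVecEnum_lt {α : Type*} [Primcodable α] (n : ℕ) {j k : α → ℕ} {q : α → ℚ}
    (hj : Primrec j) (hk : Primrec k) (hq : PrimrecRat q) :
    PrimrecPred fun v => dist (ratVecEnum n (j v)) (ratVecEnum n (k v)) < q v := by
  obtain ⟨f, hf, hdist⟩ := exists_primrecRat_eq_dist_ratVecEnum_sq n hj hk
  refine (((PrimrecRat.const 0).lt hq).and (hf.lt hq.sq)).of_eq fun v => ?_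
  rw [← Rat.cast_lt (K := ℝ), ← Rat.cast_lt (K := ℝ), Rat.cast_pow, hdist, Rat.cast_zero]
  constructor
  · exact fun ⟨hpos, hlt⟩ => lt_of_pow_lt_pow_left₀ 2 hpos.le hlt
  · exact fun h => ⟨dist_nonneg.trans_lt h, pow_lt_pow_left₀ h dist_nonneg two_ne_zero⟩

theorem exists_primrec_ratVecEnum_eq {α : Type*} [Primcodable α] {n : ℕ} {f : Fin n → α → ℚ}
    (hf : ∀ i, PrimrecRat (f i)) :
    ∃ k : α → ℕ, Primrec k ∧ ∀ v i, ratVecEnum n (k v) i = f i v := by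
  choose k hk hkf using hf
  refine ⟨_, Primrec.encode.comp (Primrec.list_ofFn hk), fun v i => ?_⟩
  simp [ratVecEnum, ← hkf]

/-! ### Bolzano-Weierstraß on Cauchy representations -/

theorem BaireRep.cauchy_dist_le {X : Type*} [MetricSpace X] {α : ℕ → X} {hα : DenseRange α}
    {p : Baire} {x : X} (h : (BaireRep.cauchy α hα).Names p x) (i : ℕ) :
    dist (α (p i)) x ≤ (2 : ℝ)⁻¹ ^ i :=
  le_of_tendsto (tendsto_const_nhds.dist h.2)
    ((eventually_ge_atTop i).mono fun j hj => h.1 i j hj)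

theorem BaireRep.cauchy_names_of_dist_le {X : Type*} [MetricSpace X] {α : ℕ → X}
    {hα : DenseRange α} {p : Baire} {x : X} (h : ∀ i, dist (α (p i)) x ≤ (2 : ℝ)⁻¹ ^ (i + 1)) :
    (BaireRep.cauchy α hα).Names p x := by
  refine ⟨fun i j hij => ?_, tendsto_iff_dist_tendsto_zero.2 <|
    squeeze_zero (fun _ => dist_nonneg) h
      ((tendsto_pow_atTop_nhds_zero_of_lt_one (by norm_num) (by norm_num)).comp
        (tendsto_add_atTop_nat 1))⟩
  have hmono : (2 : ℝ)⁻¹ ^ (j + 1) ≤ 2⁻¹ ^ (i + 1) :=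
    pow_le_pow_of_le_one (by norm_num) (by norm_num) (by omega)
  calc dist (α (p i)) (α (p j)) ≤ dist (α (p i)) x + dist (α (p j)) x := dist_triangle_right _ _ _
    _ ≤ 2⁻¹ ^ (i + 1) + 2⁻¹ ^ (i + 1) := add_le_add (h i) ((h j).trans hmono)
    _ = 2⁻¹ ^ i := by rw [pow_succ]; ring

theorem BaireRep.cauchy_names_const {X : Type*} [MetricSpace X] (α : ℕ → X) (hα : DenseRange α)
    (k : ℕ) : (BaireRep.cauchy α hα).Names (fun _ => k) (α k) :=
  cauchy_names_of_dist_le fun i => by rw [dist_self]; positivity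

/-- The representation of Baire space in which every sequence is its only name. -/
def baireRep : BaireRep Baire where
  Names p q := p = q
  unique h h' := h.symm.trans h'
  surjective q := ⟨q, rfl⟩

/-- The Bolzano-Weierstraß operator of a represented topological space: it maps a sequence with
relatively compact range to its cluster points. -/
def bwt {X : Type*} [TopologicalSpace X] (δ : BaireRep X) : MultiFunction (ℕ → X) X where
  source := δ.seq
  target := δ
  values a := {y | IsCompact (closure (Set.range a)) ∧ MapClusterPt y atTop a}

theorem mem_dom_bwt_iff {X : Type*} [TopologicalSpace X] {δ : BaireRep X} {a : ℕ → X} :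
    a ∈ (bwt δ).dom ↔ IsCompact (closure (Set.range a)) := by
  refine ⟨fun ⟨_, h, _⟩ => h, fun h => ?_⟩
  obtain ⟨y, -, hy⟩ := h.exists_mapClusterPt (f := atTop) (u := a)
    (tendsto_principal.2 (.of_forall fun s => subset_closure (Set.mem_range_self s)))
  exact ⟨y, h, hy⟩

theorem exists_computable_isLeast {β : Type*} [Primcodable β] {R : β → ℕ → Prop}
    (hR : ComputablePred fun v : β × ℕ => R v.1 v.2) (hex : ∀ v, ∃ j, R v j) :
    ∃ f : β → ℕ, Computable f ∧ ∀ v, IsLeast {j | R v j} (f v) := by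
  classical
  have htest : Computable₂ fun v j => decide (R v j) := hR.decide
  refine ⟨fun v => Nat.find (hex v), ?_, fun v =>
    ⟨Nat.find_spec (hex v), fun j hj => Nat.find_min' (hex v) hj⟩⟩
  refine (Partrec.rfind htest.partrec₂).of_eq_tot fun v => Nat.mem_rfind.2 ⟨?_, fun {m} hm => ?_⟩
  · exact Part.mem_some_iff.2 (decide_eq_true (Nat.find_spec (hex v))).symm
  · exact Part.mem_some_iff.2 (decide_eq_false (Nat.find_min (hex v) hm)).symm

theorem isCompact_closure_range_of_bddAbove {P : ℕ → Baire}
    (hP : ∀ i, BddAbove (Set.range fun s => P s i)) : IsCompact (closure (Set.range P)) := by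
  choose B hB using hP
  refine (isCompact_univ_pi fun i => (Set.finite_Iic (B i)).isCompact).closure_of_subset ?_
  rintro _ ⟨s, rfl⟩ i -
  exact hB i (Set.mem_range_self s)

theorem exists_mapClusterPt_dist_le {X : Type*} [PseudoMetricSpace X] {α : ℕ → X} {a : ℕ → X}
    {P : ℕ → Baire} {q : Baire} {ε : ℕ → ℝ} (ha : IsCompact (closure (Set.range a)))
    (hP : ∀ s i, dist (α (P s i)) (a s) ≤ ε i) (hq : MapClusterPt q atTop P) :
    ∃ y, MapClusterPt y atTop a ∧ ∀ i, dist (α (q i)) y ≤ ε i := by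
  obtain ⟨φ, hφ, hφq⟩ := hq.tendsto_subseq
  obtain ⟨y, -, ψ, hψ, hy⟩ :=
    ha.tendsto_subseq fun s => subset_closure (Set.mem_range_self (φ s))
  refine ⟨y, hy.mapClusterPt.of_comp (hφ.comp hψ).tendsto_atTop, fun i => ?_⟩
  have hentry : ∀ᶠ s in atTop, P (φ (ψ s)) i = q i :=
    (((continuous_apply i).tendsto q).comp (hφq.comp hψ.tendsto_atTop)).eventually_mem
      (isOpen_discrete {q i} |>.mem_nhds rfl)
  exact le_of_tendsto (tendsto_const_nhds.dist hy) (hentry.mono fun s hs => hs ▸ hP _ i)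

theorem bddAbove_range_of_isLeast {X : Type*} [PseudoMetricSpace X] {α a : ℕ → X}
    (hα : DenseRange α) (ha : IsCompact (closure (Set.range a))) {c k : ℕ → ℕ} {ε : ℝ} (hε : 0 < ε)
    (hc : ∀ s, dist (α (c s)) (a s) ≤ ε)
    (hk : ∀ s, IsLeast {j | dist (α j) (α (c s)) < 2 * ε} (k s)) : BddAbove (Set.range k) := by
  obtain ⟨t, ht⟩ := ha.elim_finite_subcover (fun j => Metric.ball (α j) ε)
    (fun _ => Metric.isOpen_ball) fun y _ => Set.mem_iUnion.2 (hα.exists_dist_lt y hε)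
  refine ⟨t.sup id, ?_⟩
  rintro _ ⟨s, rfl⟩
  obtain ⟨j, hjt, hj⟩ := Set.mem_iUnion₂.1 (ht (subset_closure (Set.mem_range_self s)))
  refine ((hk s).2 (?_ : dist (α j) (α (c s)) < 2 * ε)).trans (Finset.le_sup (f := id) hjt)
  rw [Metric.mem_ball'] at hj
  linarith [hc s, dist_triangle_right (α j) (α (c s)) (a s)]

/-- The least indices of sufficiently good approximations form names that stay pointwise bounded
as long as the points stay in a compact set. -/
theorem bwt_cauchy_strongReducible_bwt_baireRep {X : Type*} [MetricSpace X] {α : ℕ → X}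
    (hα : DenseRange α)
    (hdist : ComputablePred fun v : (ℕ × ℕ) × ℕ => dist (α v.2) (α v.1.2) < 2⁻¹ ^ v.1.1) :
    (bwt (BaireRep.cauchy α hα)).StrongReducible (bwt baireRep) := by
  obtain ⟨f, hf, hleast⟩ := exists_computable_isLeast
    (R := fun (v : ℕ × ℕ) j => dist (α j) (α v.2) < 2⁻¹ ^ v.1) hdist
    fun v => ⟨v.2, by rw [dist_self]; positivity⟩
  have hright : Computable fun v : ℕ => v.unpair.2 := Computable.snd.comp .unpair
  have hquery : Computable fun v : ℕ => v.unpair.1.pair (v.unpair.2 + 3) :=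
    Primrec₂.natPair.to_comp.comp (Computable.fst.comp .unpair)
      (Primrec.nat_add.to_comp.comp hright (.const 3))
  have hf' : Computable₂ fun v a : ℕ => f (v.unpair.2 + 2, a) :=
    hf.comp ((Primrec.nat_add.to_comp.comp (hright.comp .fst) (.const 2)).pair .snd)
  refine .of_functional (.query hquery hf') .oracle fun p a hp ha => ?_
  have hK := mem_dom_bwt_iff.1 ha
  have hp' (s i) := BaireRep.cauchy_dist_le (hp s) (i + 3)
  set P : ℕ → Baire := fun s i => f (i + 2, p (s.pair (i + 3))) with hPdef
  have hP (s i) : dist (α (P s i)) (a s) ≤ 2⁻¹ ^ (i + 1) := by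
    refine (dist_triangle _ (α (p (s.pair (i + 3)))) _).trans
      ((add_le_add (hleast (i + 2, _)).1.le (hp' s i)).trans ?_)
    rw [pow_succ _ (i + 2), pow_succ _ (i + 1)]
    linarith [show (0 : ℝ) < 2⁻¹ ^ (i + 1) by positivity]
  have hbdd (i) : BddAbove (Set.range fun s => P s i) := by
    refine bddAbove_range_of_isLeast hα hK (by positivity) (fun s => hp' s i) fun s => ?_
    convert! hleast (i + 2, p (s.pair (i + 3))) using 5
    rw [pow_succ _ (i + 2)]
    ring
  refine ⟨P, mem_dom_bwt_iff.2 (isCompact_closure_range_of_bddAbove hbdd),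
    fun s => by simp [baireRep, hPdef], ?_⟩
  rintro q ⟨-, hq⟩ r rfl
  obtain ⟨y, hy, hqy⟩ := exists_mapClusterPt_dist_le hK hP hq
  exact ⟨r, y, fun _ => Part.mem_some _, ⟨hK, hy⟩, BaireRep.cauchy_names_of_dist_le (hα := hα) hqy⟩

/-! ### Coding sequences of natural numbers by real numbers -/

/-- An injective code of finite sequences of natural numbers by rational numbers in `[0, 1]`, such
that the codes of all extensions of `l` lie in an interval of length `listCode.width l`. -/
def listCode (l : List ℕ) : ℚ :=
  l.foldr (fun a t => (4 + t) * 8⁻¹ ^ (a + 1)) 0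

namespace listCode

/-- The length of the interval occupied by the codes of the extensions of a finite sequence. -/
def width (l : List ℕ) : ℚ :=
  l.foldr (fun a t => t * 8⁻¹ ^ (a + 1)) 1

theorem cons (a : ℕ) (l : List ℕ) : listCode (a :: l) = (4 + listCode l) * 8⁻¹ ^ (a + 1) := rfl

theorem width_cons (a : ℕ) (l : List ℕ) : width (a :: l) = width l * 8⁻¹ ^ (a + 1) := rfl

theorem primrecRat : PrimrecRat listCode := by
  refine .list_foldr (((PrimrecRat.const 4).add (.ratEnum .snd)).mul ?_) 0
  exact_mod_cast PrimrecRat.invPow 8 (Primrec.succ.comp .fst)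

theorem primrecRat_width : PrimrecRat width := by
  refine .list_foldr ((PrimrecRat.ratEnum .snd).mul ?_) 1
  exact_mod_cast PrimrecRat.invPow 8 (Primrec.succ.comp .fst)

theorem eight_inv_pow_succ_le (a : ℕ) : (8⁻¹ : ℚ) ^ (a + 1) ≤ 8⁻¹ :=
  pow_le_of_le_one (by norm_num) (by norm_num) a.succ_ne_zero

theorem mem_Icc (l : List ℕ) : listCode l ∈ Set.Icc 0 1 := by
  induction l with
  | nil => exact ⟨le_rfl, zero_le_one⟩
  | cons a l ih =>
    have hpos : (0 : ℚ) < 8⁻¹ ^ (a + 1) := by positivity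
    rw [cons]
    exact ⟨mul_nonneg (by linarith [ih.1]) hpos.le,
      by nlinarith [ih.2, eight_inv_pow_succ_le a]⟩

theorem width_mem_Ioc (l : List ℕ) : width l ∈ Set.Ioc 0 1 := by
  induction l with
  | nil => exact ⟨zero_lt_one, le_rfl⟩
  | cons a l ih =>
    have hpos : (0 : ℚ) < 8⁻¹ ^ (a + 1) := by positivity
    rw [width_cons]
    exact ⟨mul_pos ih.1 hpos, by nlinarith [ih.2, eight_inv_pow_succ_le a]⟩

theorem append (l l' : List ℕ) : listCode (l ++ l') = listCode l + width l * listCode l' := by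
  induction l with
  | nil => simp [listCode, width]
  | cons a l ih =>
    rw [List.cons_append, cons, cons, width_cons, ih]
    ring

theorem abs_append_sub_le (l l' : List ℕ) : |listCode (l ++ l') - listCode l| ≤ width l := by
  have hwidth := (width_mem_Ioc l).1
  rw [append, add_sub_cancel_left, abs_of_nonneg (mul_nonneg hwidth.le (mem_Icc l').1)]
  exact mul_le_of_le_one_right hwidth.le (mem_Icc l').2

theorem separation_of_head_lt {a b : ℕ} (h : a < b) (l l' : List ℕ) :
    2 * (width (a :: l) + width (b :: l')) ≤ listCode (a :: l) - listCode (b :: l') := by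
  obtain ⟨c, rfl⟩ := Nat.exists_eq_add_of_lt h
  simp only [cons, width_cons]
  set u : ℚ := 8⁻¹ ^ (a + 1)
  set v : ℚ := 8⁻¹ ^ (a + c + 1 + 1)
  have hu : 0 < u := by positivity
  have hv : 0 < v := by positivity
  have huv : v ≤ u * 8⁻¹ := by
    calc v = u * 8⁻¹ ^ (c + 1) := by simp only [u, v]; ring
      _ ≤ u * 8⁻¹ := by gcongr; exact eight_inv_pow_succ_le c
  have hcode := mul_nonneg (mem_Icc l).1 hu.le
  have hcode' := mul_le_mul_of_nonneg_right (mem_Icc l').2 hv.le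
  have hwidth := mul_le_mul_of_nonneg_right (width_mem_Ioc l).2 hu.le
  have hwidth' := mul_le_mul_of_nonneg_right (width_mem_Ioc l').2 hv.le
  linarith

theorem separation {l l' : List ℕ} (hlen : l.length = l'.length) (hne : l ≠ l') :
    2 * (width l + width l') ≤ |listCode l - listCode l'| := by
  induction l generalizing l' with
  | nil => exact absurd (List.eq_nil_of_length_eq_zero hlen.symm).symm hne
  | cons a l ih =>
    cases l' with
    | nil => simp at hlen
    | cons b l' =>
      rcases lt_trichotomy a b with h | rfl | h
      · exact (separation_of_head_lt h l l').trans (le_abs_self _)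
      · have hpos : (0 : ℚ) < 8⁻¹ ^ (a + 1) := by positivity
        have htail := mul_le_mul_of_nonneg_right
          (ih (by simpa using hlen) fun h => hne (h ▸ rfl)) hpos.le
        rw [cons, cons, width_cons, width_cons, ← sub_mul, abs_mul, abs_of_pos hpos,
          add_sub_add_left_eq_sub]
        linarith
      · rw [abs_sub_comm, add_comm]
        exact (separation_of_head_lt h l' l).trans (le_abs_self _)

theorem eq_of_abs_sub_lt {l l' : List ℕ} (hlen : l.length = l'.length) {y : ℝ}
    (h : |y - listCode l| < 2 * width l) (h' : |y - listCode l'| < 2 * width l') : l = l' := by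
  by_contra hne
  have hsep : (2 * (width l + width l') : ℝ) ≤ |(listCode l : ℝ) - listCode l'| := by
    exact_mod_cast separation hlen hne
  linarith [abs_sub_le (listCode l : ℝ) y (listCode l'), abs_sub_comm (listCode l : ℝ) y]

theorem exists_mapClusterPt_abs_sub_le {P : ℕ → Baire} {y : ℝ}
    (hP : IsCompact (closure (Set.range P)))
    (hy : MapClusterPt y atTop fun s => (listCode ((List.range s).map (P s)) : ℝ)) :
    ∃ q, MapClusterPt q atTop P ∧
      ∀ i, |y - listCode ((List.range i).map q)| ≤ width ((List.range i).map q) := by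
  obtain ⟨φ, hφ, hφy⟩ := hy.tendsto_subseq
  obtain ⟨q, -, ψ, hψ, hq⟩ :=
    hP.tendsto_subseq fun s => subset_closure (Set.mem_range_self (φ s))
  have hφψ : Tendsto (φ ∘ ψ) atTop atTop := (hφ.comp hψ).tendsto_atTop
  refine ⟨q, hq.mapClusterPt.of_comp hφψ, fun i => ?_⟩
  have hagree : ∀ᶠ s in atTop, ∀ j < i, P (φ (ψ s)) j = q j :=
    (Set.finite_Iio i).eventually_all.2 fun j _ =>
      (((continuous_apply j).tendsto q).comp hq).eventually_mem
        ((isOpen_discrete {q j}).mem_nhds rfl)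
  have hlim : Tendsto (fun s => |(listCode ((List.range (φ (ψ s))).map (P (φ (ψ s)))) : ℝ) -
      listCode ((List.range i).map q)|) atTop (𝓝 |y - listCode ((List.range i).map q)|) :=
    ((hφy.comp hψ.tendsto_atTop).sub_const _).abs
  refine le_of_tendsto hlim ?_
  filter_upwards [hagree, hφψ.eventually_ge_atTop i] with s hs hi
  obtain ⟨k, hk⟩ := Nat.exists_eq_add_of_le hi
  rw [Function.comp_apply] at hk
  have hmap : (List.range i).map (P (φ (ψ s))) = (List.range i).map q :=
    List.map_congr_left fun j hj => hs j (List.mem_range.1 hj)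
  rw [hk, List.range_add, List.map_append, ← hk, hmap]
  exact_mod_cast abs_append_sub_le _ _

theorem primrecPred_search :
    PrimrecPred fun v : ℕ × ℕ × ℕ =>
      (Denumerable.ofNat (List ℕ) v.2.1.unpair.1).length = v.1 + 1 ∧
        |ratEnum v.2.2 - listCode (Denumerable.ofNat (List ℕ) v.2.1.unpair.1)| +
          ((2 : ℕ) : ℚ)⁻¹ ^ v.2.1.unpair.2 <
            2 * width (Denumerable.ofNat (List ℕ) v.2.1.unpair.1) := by
  have hpair : Primrec fun v : ℕ × ℕ × ℕ => v.2.1.unpair :=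
    Primrec.unpair.comp (Primrec.fst.comp .snd)
  have hlist : Primrec fun v : ℕ × ℕ × ℕ => Denumerable.ofNat (List ℕ) v.2.1.unpair.1 :=
    (Primrec.ofNat (List ℕ)).comp (Primrec.fst.comp hpair)
  have hdist := ((PrimrecRat.ratEnum (Primrec.snd.comp .snd)).sub (primrecRat.comp hlist)).abs
  exact (Primrec.eq.comp (Primrec.list_length.comp hlist) (Primrec.succ.comp .fst)).and
    ((hdist.add (.invPow 2 (Primrec.snd.comp hpair))).lt
      ((PrimrecRat.const 2).mul (primrecRat_width.comp hlist)))

theorem exists_recursiveFunctional_decode :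
    ∃ Φ, RecursiveFunctional Φ ∧ ∀ (r : Baire) (y : ℝ) (q : Baire), realRep.Names r y →
      (∀ i, |y - listCode ((List.range i).map q)| ≤ width ((List.range i).map q)) →
      ∀ n, q n ∈ Φ r n := by
  have houtput : Primrec fun v : ℕ × ℕ × ℕ =>
      (Denumerable.ofNat (List ℕ) v.2.1.unpair.1).getD v.1 0 :=
    (Primrec.list_getD 0).comp ((Primrec.ofNat (List ℕ)).comp
      (Primrec.fst.comp (Primrec.unpair.comp (Primrec.fst.comp .snd)))) .fst
  obtain ⟨Φ, hΦ, hsearch⟩ := RecursiveFunctional.exists_search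
    (Primrec.snd.comp .unpair).to_comp (R := fun n w a =>
      (Denumerable.ofNat (List ℕ) w.unpair.1).length = n + 1 ∧
        |ratEnum a - listCode (Denumerable.ofNat (List ℕ) w.unpair.1)| +
          ((2 : ℕ) : ℚ)⁻¹ ^ w.unpair.2 < 2 * width (Denumerable.ofNat (List ℕ) w.unpair.1))
    primrecPred_search houtput.to_comp
  refine ⟨Φ, hΦ, fun r y q hr hq n => ?_⟩
  have hdist (m) : |(ratEnum (r m) : ℝ) - y| ≤ 2⁻¹ ^ m := BaireRep.cauchy_dist_le hr m
  set l := (List.range (n + 1)).map q with hl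
  have hlen : l.length = n + 1 := by simp [hl]
  have hwidth : (0 : ℝ) < width l := by exact_mod_cast (width_mem_Ioc l).1
  obtain ⟨w, ⟨hwlen, hw⟩, hwΦ⟩ := hsearch r n <| by
    obtain ⟨m, hm⟩ := exists_pow_lt_of_lt_one (half_pos hwidth) (by norm_num : (2⁻¹ : ℝ) < 1)
    refine ⟨Nat.pair (Encodable.encode l) m, ?_⟩
    simp only [Nat.unpair_pair, Denumerable.ofNat_encode, ← Rat.cast_lt (K := ℝ)]
    push_cast
    exact ⟨hlen, by linarith [abs_sub_le (ratEnum (r m) : ℝ) y (listCode l), hdist m, hq (n + 1)]⟩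
  rw [← Rat.cast_lt (K := ℝ)] at hw
  push_cast at hw
  set l' := Denumerable.ofNat (List ℕ) w.unpair.1
  have hl' : l' = l := by
    refine eq_of_abs_sub_lt (hwlen.trans hlen.symm) (y := y) ?_ (by linarith [hq (n + 1)])
    linarith [abs_sub_le y (ratEnum (r w.unpair.2)) (listCode l'), hdist w.unpair.2,
      abs_sub_comm y (ratEnum (r w.unpair.2))]
  simpa [hl', hl] using hwΦ

end listCode

theorem bwt_baireRep_strongReducible_bwtReal : (bwt baireRep).StrongReducible bwtReal := by
  obtain ⟨c, hc, hcode⟩ := listCode.primrecRat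
  obtain ⟨Φ, hΦ, hdecode⟩ := listCode.exists_recursiveFunctional_decode
  have hH : RecursiveFunctional fun p k =>
      Part.some (c ((List.range k.unpair.1).map fun i => p (k.unpair.1.pair i))) := by
    refine .of_modulus (b := fun k => k.unpair.1.pair k.unpair.1)
      (F := fun p k => c ((List.range k.unpair.1).map fun i => p (k.unpair.1.pair i)))
      ?_ ?_ fun p q k hpq => ?_
    · exact (Primrec₂.natPair.comp (Primrec.fst.comp .unpair) (Primrec.fst.comp .unpair)).to_comp
    · have hleft : Primrec fun v : List ℕ × ℕ => v.2.unpair.1 :=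
        Primrec.fst.comp (Primrec.unpair.comp .snd)
      have hentry : Primrec₂ fun (v : List ℕ × ℕ) (i : ℕ) => v.1.getD (v.2.unpair.1.pair i) 0 :=
        (Primrec.list_getD 0).comp (Primrec.fst.comp .fst)
          (Primrec₂.natPair.comp (hleft.comp .fst) .snd)
      exact (hc.comp (Primrec.list_map (Primrec.list_range.comp hleft) hentry)).to_comp
    · exact congrArg c (List.map_congr_left fun i hi =>
        hpq _ (Nat.pair_lt_pair_right _ (List.mem_range.1 hi)))
  refine .of_functional hH hΦ fun p P hp hP => ?_
  set e : ℕ → ℝ := fun s => listCode ((List.range s).map (P s))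
  have hcompact : IsCompact (closure (Set.range e)) := by
    refine (isCompact_Icc (a := (0 : ℝ)) (b := 1)).closure_of_subset ?_
    rintro _ ⟨s, rfl⟩
    simp only [e, Set.mem_Icc]
    exact_mod_cast listCode.mem_Icc ((List.range s).map (P s))
  refine ⟨e, mem_dom_bwt_iff (δ := realRep).2 hcompact, fun s => ?_, fun y hy r hr => ?_⟩
  · have hPs : (fun i => p (s.pair i)) = P s := hp s
    simp only [Nat.unpair_pair, hPs, e, ← hcode]
    exact BaireRep.cauchy_names_const _ denseRange_ratEnum _
  · obtain ⟨q, hqP, hq⟩ := listCode.exists_mapClusterPt_abs_sub_le (mem_dom_bwt_iff.1 hP) hy.2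
    exact ⟨q, q, hdecode r y q hr hq, ⟨mem_dom_bwt_iff.1 hP, hqP⟩, rfl⟩

/-! ### Nearest points as limits of centres of balls -/

theorem nonnegRatEnum_nonneg (m : ℕ) : 0 ≤ nonnegRatEnum m := by
  unfold nonnegRatEnum
  positivity

section BallWeight

variable {X : Type*} [MetricSpace X] {α : ℕ → X}

/-- A quantity for the `k`-th basic ball which, if that ball meets a set `A`, exceeds
`1 + Metric.infDist x A ^ 2` by at least the radius of the ball. For rational centre and `x` in
Euclidean space it is rational, unlike the distance of `x` from the centre. -/
noncomputable def ballWeight (α : ℕ → X) (x : X) (k : ℕ) : ℝ :=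
  (1 + nonnegRatEnum k.unpair.2) * (1 + nonnegRatEnum k.unpair.2 + dist x (α k.unpair.1) ^ 2)

theorem one_add_dist_sq_le_ballWeight (x : X) (k : ℕ) :
    1 + dist x (α k.unpair.1) ^ 2 ≤ ballWeight α x k := by
  have hradius : (0 : ℝ) ≤ nonnegRatEnum k.unpair.2 := Rat.cast_nonneg.2 (nonnegRatEnum_nonneg _)
  unfold ballWeight
  nlinarith [mul_nonneg hradius (sq_nonneg (dist x (α k.unpair.1)))]

theorem infDist_lt_radius {A : Set X} {k : ℕ} (h : (basicBall α k ∩ A).Nonempty) :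
    Metric.infDist (α k.unpair.1) A < nonnegRatEnum k.unpair.2 := by
  obtain ⟨z, hz, hzA⟩ := h
  exact (Metric.infDist_le_dist_of_mem hzA).trans_lt (Metric.mem_ball'.1 hz)

theorem one_add_infDist_sq_add_radius_le_ballWeight {A : Set X} {k : ℕ}
    (h : (basicBall α k ∩ A).Nonempty) (x : X) :
    1 + Metric.infDist x A ^ 2 + nonnegRatEnum k.unpair.2 ≤ ballWeight α x k := by
  set d := dist x (α k.unpair.1)
  set r := (nonnegRatEnum k.unpair.2 : ℝ)
  have hradius : 0 ≤ r := Rat.cast_nonneg.2 (nonnegRatEnum_nonneg _)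
  have hdist : Metric.infDist x A ≤ d + r := by
    linarith [Metric.infDist_le_infDist_add_dist (s := A) (x := x) (y := α k.unpair.1),
      infDist_lt_radius h]
  calc 1 + Metric.infDist x A ^ 2 + r ≤ 1 + (d + r) ^ 2 + r := by
        gcongr; exact Metric.infDist_nonneg
    _ ≤ 1 + (d + r) ^ 2 + r + r * (1 - d) ^ 2 := le_add_of_nonneg_right (by positivity)
    _ = (1 + r) * (1 + r + d ^ 2) := by ring

theorem exists_ballWeight_lt (hα : DenseRange α) {A : Set X} (hA : A.Nonempty) (x : X) {C : ℝ}
    (hC : 1 + Metric.infDist x A ^ 2 < C) :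
    ∃ k, (basicBall α k ∩ A).Nonempty ∧ ballWeight α x k < C := by
  set D := Metric.infDist x A
  have hsmall : ∀ᶠ r : ℝ in 𝓝 0, (1 + r) * (1 + r + (D + 2 * r) ^ 2) < C :=
    (Continuous.tendsto (by fun_prop) 0).eventually_lt_const (by simpa using hC)
  obtain ⟨η, hη, hball⟩ := Metric.eventually_nhds_iff.1 hsmall
  obtain ⟨m, hm, hmη⟩ := exists_nonnegRatEnum_between hη
  obtain ⟨a, haA, ha⟩ := (Metric.infDist_lt_iff hA).1 (lt_add_of_pos_right D hm)
  obtain ⟨j, hj⟩ := hα.exists_dist_lt a hm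
  refine ⟨Nat.pair j m, ⟨a, by simpa [basicBall] using hj, haA⟩, ?_⟩
  have hdist : dist x (α j) ≤ D + 2 * nonnegRatEnum m := by linarith [dist_triangle x a (α j)]
  refine lt_of_le_of_lt ?_ (hball (y := nonnegRatEnum m) ?_)
  · rw [ballWeight, Nat.unpair_pair]
    gcongr
  · rwa [Real.dist_0_eq_abs, abs_of_pos hm]

theorem continuous_ballWeight (k : ℕ) : Continuous fun x => ballWeight α x k := by
  unfold ballWeight
  fun_prop

section Minimizing

variable {A : Set X} {x : X} {u : ℕ → X} {k : ℕ → ℕ} (hα : DenseRange α) (hA : A.Nonempty)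
  (hu : Tendsto u atTop (𝓝 x)) (hk : ∀ᶠ s in atTop, (basicBall α (k s) ∩ A).Nonempty)
  (hmin : ∀ j, (basicBall α j ∩ A).Nonempty →
    ∀ᶠ s in atTop, ballWeight α (u s) (k s) ≤ ballWeight α (u s) j)

include hα hA hu hk hmin

theorem tendsto_ballWeight_minimizing :
    Tendsto (fun s => ballWeight α (u s) (k s)) atTop (𝓝 (1 + Metric.infDist x A ^ 2)) := by
  have hlim : Tendsto (fun s => 1 + Metric.infDist (u s) A ^ 2) atTop
      (𝓝 (1 + Metric.infDist x A ^ 2)) :=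
    ((((Metric.continuous_infDist_pt A).tendsto x).comp hu).pow 2).const_add 1
  refine tendsto_order.2 ⟨fun a ha => ?_, fun a ha => ?_⟩
  · filter_upwards [hk, hlim.eventually_const_lt ha] with s hs hsa
    have hradius : (0 : ℝ) ≤ nonnegRatEnum (k s).unpair.2 :=
      Rat.cast_nonneg.2 (nonnegRatEnum_nonneg _)
    linarith [one_add_infDist_sq_add_radius_le_ballWeight hs (u s)]
  · obtain ⟨j, hj, hja⟩ := exists_ballWeight_lt hα hA x ha
    filter_upwards [hmin j hj,
      (((continuous_ballWeight j).tendsto x).comp hu).eventually_lt_const hja] with s hs hsa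
    exact hs.trans_lt hsa

theorem tendsto_infDist_center_minimizing :
    Tendsto (fun s => Metric.infDist (α (k s).unpair.1) A) atTop (𝓝 0) := by
  have hexcess : Tendsto (fun s => ballWeight α (u s) (k s) - (1 + Metric.infDist (u s) A ^ 2))
      atTop (𝓝 0) := by
    simpa using (tendsto_ballWeight_minimizing hα hA hu hk hmin).sub
      (((((Metric.continuous_infDist_pt A).tendsto x).comp hu).pow 2).const_add 1)
  refine squeeze_zero' (.of_forall fun s => Metric.infDist_nonneg) (hk.mono fun s hs => ?_) hexcess
  linarith [infDist_lt_radius hs, one_add_infDist_sq_add_radius_le_ballWeight hs (u s)]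

theorem isBounded_range_center_minimizing :
    Bornology.IsBounded (Set.range fun s => α (k s).unpair.1) := by
  obtain ⟨C, hC⟩ := (tendsto_ballWeight_minimizing hα hA hu hk hmin).bddAbove_range
  obtain ⟨B, hB⟩ := (tendsto_iff_dist_tendsto_zero.1 hu).bddAbove_range
  refine (Metric.isBounded_closedBall (x := x) (r := B + C)).subset ?_
  rintro _ ⟨s, rfl⟩
  have hdist := one_add_dist_sq_le_ballWeight (α := α) (u s) (k s)
  have hCs : ballWeight α (u s) (k s) ≤ C := hC (Set.mem_range_self s)
  have hBs : dist (u s) x ≤ B := hB (Set.mem_range_self s)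
  rw [Metric.mem_closedBall]
  nlinarith [dist_triangle_left (α (k s).unpair.1) x (u s),
    sq_nonneg (dist (u s) (α (k s).unpair.1) - 1)]

theorem dist_eq_infDist_of_mapClusterPt_center (hAc : IsClosed A) {y : X}
    (hy : MapClusterPt y atTop fun s => α (k s).unpair.1) :
    y ∈ A ∧ dist x y = Metric.infDist x A := by
  obtain ⟨φ, hφ, hlim⟩ := hy.tendsto_subseq
  have hyA : y ∈ A := (hAc.mem_iff_infDist_zero hA).2 <| tendsto_nhds_unique
    (((Metric.continuous_infDist_pt A).tendsto y).comp hlim)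
    ((tendsto_infDist_center_minimizing hα hA hu hk hmin).comp hφ.tendsto_atTop)
  have hdist : 1 + dist x y ^ 2 ≤ 1 + Metric.infDist x A ^ 2 :=
    le_of_tendsto_of_tendsto' ((((hu.comp hφ.tendsto_atTop).dist hlim).pow 2).const_add 1)
      ((tendsto_ballWeight_minimizing hα hA hu hk hmin).comp hφ.tendsto_atTop)
      fun s => one_add_dist_sq_le_ballWeight (u (φ s)) (k (φ s))
  refine ⟨hyA, le_antisymm ?_ (Metric.infDist_le_dist_of_mem hyA)⟩
  exact le_of_sq_le_sq (by linarith) Metric.infDist_nonneg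

end Minimizing

end BallWeight

theorem exists_primrecRat_eq_ballWeight {β : Type*} [Primcodable β] (n : ℕ) {j k : β → ℕ}
    (hj : Primrec j) (hk : Primrec k) :
    ∃ w : β → ℚ, PrimrecRat w ∧
      ∀ v, (w v : ℝ) = ballWeight (ratVecEnum n) (ratVecEnum n (j v)) (k v) := by
  have hunpair : Primrec fun v => (k v).unpair := Primrec.unpair.comp hk
  obtain ⟨d, hd, hdist⟩ := exists_primrecRat_eq_dist_ratVecEnum_sq n hj (Primrec.fst.comp hunpair)
  have hradius := (PrimrecRat.const 1).add (.nonnegRatEnum (Primrec.snd.comp hunpair))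
  refine ⟨_, hradius.mul (hradius.add hd), fun v => ?_⟩
  push_cast
  rw [hdist, ballWeight]

theorem exists_primrec₂_argmin {β : Type*} [Primcodable β] {R : β → ℕ → Prop}
    {w : β → ℕ → ℚ} (hR : PrimrecPred fun v : β × ℕ => R v.1 v.2)
    (hw : PrimrecRat fun v : β × ℕ => w v.1 v.2) :
    ∃ b : β → ℕ → ℕ, Primrec₂ b ∧
      ∀ v s, ∀ i < s, R v i → b v s < s ∧ R v (b v s) ∧ w v (b v s) ≤ w v i := by
  classical
  have hold : Primrec fun v : β × ℕ × ℕ => (v.1, v.2.2) := Primrec.fst.pair (Primrec.snd.comp .snd)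
  have hnew : Primrec fun v : β × ℕ × ℕ => (v.1, v.2.1) := Primrec.fst.pair (Primrec.fst.comp .snd)
  have hkeep : PrimrecPred fun v : β × ℕ × ℕ =>
      R v.1 v.2.2 ∧ (¬R v.1 v.2.1 ∨ w v.1 v.2.2 ≤ w v.1 v.2.1) :=
    (hR.comp hold).and ((hR.comp hnew).not.or ((hw.comp hold).le (hw.comp hnew)))
  refine ⟨_, Primrec.nat_rec (.const 0) (Primrec.ite hkeep (Primrec.snd.comp .snd)
    (Primrec.fst.comp .snd)).to₂, fun v s => ?_⟩
  have hlt (s : ℕ) : Nat.rec 0 (fun i b => if R v b ∧ (¬R v i ∨ w v b ≤ w v i) then b else i) s <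
      s + 1 := by
    induction s with
    | zero => exact Nat.zero_lt_one
    | succ s ih => dsimp only; split_ifs <;> omega
  induction s with
  | zero => simp
  | succ s ih => grind

theorem exists_recursiveFunctional_bestBall (n : ℕ) :
    ∃ k : Baire → ℕ → ℕ, RecursiveFunctional (fun p s => Part.some (k p s)) ∧
      ∀ p s, ((∃ i < s, p (2 * i + 1) ≠ 0) → ∃ i, p (2 * i + 1) = k p s + 1) ∧
        ∀ i < s, ∀ j, p (2 * i + 1) = j + 1 →
          ballWeight (ratVecEnum n) (ratVecEnum n (p (2 * s))) (k p s) ≤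
            ballWeight (ratVecEnum n) (ratVecEnum n (p (2 * s))) j := by
  have hentry : Primrec fun v : (List ℕ × ℕ) × ℕ => v.1.1.getD (2 * v.2 + 1) 0 :=
    (Primrec.list_getD 0).comp (Primrec.fst.comp .fst) (Primrec.nat_double_succ.comp .snd)
  have hpoint : Primrec fun v : (List ℕ × ℕ) × ℕ => v.1.1.getD (2 * v.1.2) 0 :=
    (Primrec.list_getD 0).comp (Primrec.fst.comp .fst)
      (Primrec.nat_double.comp (Primrec.snd.comp .fst))
  obtain ⟨w, hw, hweight⟩ := exists_primrecRat_eq_ballWeight n hpoint (Primrec.pred.comp hentry)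
  obtain ⟨b, hb, hbest⟩ := exists_primrec₂_argmin (w := fun v i => w (v, i))
    (R := fun v i => v.1.getD (2 * i + 1) 0 ≠ 0) (Primrec.eq.comp hentry (.const 0)).not hw
  have hk : Computable₂ fun (l : List ℕ) s => l.getD (2 * b (l, s) s + 1) 0 - 1 :=
    (Primrec.pred.comp (hentry.comp (Primrec.id.pair (hb.comp .id .snd)))).to_comp
  refine ⟨_, .of_initialSegment Primrec.nat_double_succ.to_comp hk, fun p s => ?_⟩
  set l := (List.range (2 * s + 1)).map p
  have hl {i} (hi : i < 2 * s + 1) : l.getD i 0 = p i := by simp [l, hi]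
  have hl' {i} (hi : i < s) : l.getD (2 * i + 1) 0 = p (2 * i + 1) := hl (by omega)
  have hbest' {i : ℕ} (hi : i < s) (hne : p (2 * i + 1) ≠ 0) := hbest (l, s) s i hi
    (by rwa [hl' hi])
  refine ⟨fun ⟨i, hi, hne⟩ => ?_, fun i hi j hj => ?_⟩
  · obtain ⟨hbs, hbne, -⟩ := hbest' hi hne
    exact ⟨b (l, s) s, by rw [← hl' hbs, Nat.sub_add_cancel (Nat.pos_of_ne_zero hbne)]⟩
  · obtain ⟨-, -, hle⟩ := hbest' hi (hj.trans_ne j.succ_ne_zero)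
    have hij : l.getD (2 * i + 1) 0 = j + 1 := (hl' hi).trans hj
    rw [← Rat.cast_le (K := ℝ), hweight, hweight] at hle
    simpa only [hij, hl (by omega : 2 * s < 2 * s + 1), Nat.pred_eq_sub_one, Nat.add_sub_cancel]
      using hle

theorem projPos_strongReducible_bwt_euclideanRep (n : ℕ) :
    (projPos n).StrongReducible (bwt (euclideanRep n)) := by
  obtain ⟨k, hk, hbest⟩ := exists_recursiveFunctional_bestBall n
  have hH : RecursiveFunctional fun p m => Part.some (k p m.unpair.1).unpair.1 :=
    (RecursiveFunctional.left.comp (hk.comp .left)).of_eq fun p m => by simp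
  refine .of_functional hH .oracle fun p z ⟨hx, hA⟩ hz => ?_
  have hne : (z.2 : Set (EuclideanSpace ℝ (Fin n))).Nonempty := hz.imp fun _ hy => hy.1
  have hdense := denseRange_ratVecEnum n
  have hmeets : ∀ᶠ s in atTop, (basicBall (ratVecEnum n) (k p s) ∩ z.2).Nonempty := by
    obtain ⟨j, hj, -⟩ := exists_ballWeight_lt hdense hne z.1 (lt_add_one _)
    obtain ⟨i, hi⟩ := (hA j).2 hj
    filter_upwards [eventually_gt_atTop i] with s hs
    exact (hA _).1 ((hbest p s).1 ⟨i, hs, hi.trans_ne j.succ_ne_zero⟩)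
  have hmin (j) (hj : (basicBall (ratVecEnum n) j ∩ z.2).Nonempty) : ∀ᶠ s in atTop,
      ballWeight (ratVecEnum n) (ratVecEnum n (p (2 * s))) (k p s) ≤
        ballWeight (ratVecEnum n) (ratVecEnum n (p (2 * s))) j := by
    obtain ⟨i, hi⟩ := (hA j).2 hj
    filter_upwards [eventually_gt_atTop i] with s hs
    exact (hbest p s).2 i hs j hi
  have hcompact :=
    (isBounded_range_center_minimizing hdense hne hx.2 hmeets hmin).isCompact_closure
  refine ⟨fun s => ratVecEnum n (k p s).unpair.1, mem_dom_bwt_iff.2 hcompact, fun s => ?_,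
    fun y hy r hr => ⟨r, y, fun _ => Part.mem_some _, ?_, hr⟩⟩
  · simp only [Nat.unpair_pair]
    exact BaireRep.cauchy_names_const _ hdense _
  · exact dist_eq_infDist_of_mapClusterPt_center hdense hne hx.2 hmeets hmin z.2.isClosed hy.2

/-! ### Cluster points as nearest points -/

theorem mapClusterPt_of_mem_closure_range {X : Type*} [TopologicalSpace X] [T1Space X]
    {u : ℕ → X} {y : X} (hy : y ∈ closure (Set.range u)) (hne : ∀ s, u s ≠ y) :
    MapClusterPt y atTop u := by
  refine mapClusterPt_iff_frequently.2 fun U hU => frequently_atTop.2 fun N => ?_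
  have hinit : (u '' Set.Iio N)ᶜ ∈ 𝓝 y :=
    ((Set.finite_Iio N).image u).isClosed.isOpen_compl.mem_nhds fun ⟨s, _, hs⟩ => hne s hs
  obtain ⟨_, ⟨hsU, hsN⟩, s, rfl⟩ := mem_closure_iff_nhds.1 hy _ (inter_mem hU hinit)
  exact ⟨s, le_of_not_gt fun hs => hsN ⟨s, hs, rfl⟩, hsU⟩

theorem mapClusterPt_of_tendsto_dist_zero {X : Type*} [PseudoMetricSpace X] {u v : ℕ → X} {y : X}
    (hu : MapClusterPt y atTop u) (huv : Tendsto (fun s => dist (u s) (v s)) atTop (𝓝 0)) :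
    MapClusterPt y atTop v := by
  obtain ⟨φ, hφ, hφy⟩ := hu.tendsto_subseq
  exact (hφy.congr_dist (huv.comp hφ.tendsto_atTop)).mapClusterPt.of_comp hφ.tendsto_atTop

theorem BaireRep.positive_names_closure_range {X : Type*} [MetricSpace X] {α : ℕ → X}
    (hα : DenseRange α) (c : ℕ → ℕ)
    [DecidablePred fun i : ℕ => α (c i.unpair.1) ∈ basicBall α i.unpair.2] :
    (BaireRep.positive α hα).Names
      (fun i => if α (c i.unpair.1) ∈ basicBall α i.unpair.2 then i.unpair.2 + 1 else 0)
      ⟨closure (Set.range (α ∘ c)), isClosed_closure⟩ := by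
  intro k
  have hopen : IsOpen (basicBall α k) := Metric.isOpen_ball
  rw [Set.inter_comm]
  refine Iff.trans ?_ (closure_inter_open_nonempty_iff hopen).symm
  constructor
  · rintro ⟨i, hi⟩
    dsimp only at hi
    split_ifs at hi with hmem
    obtain rfl := Nat.succ_injective hi
    exact ⟨_, Set.mem_range_self i.unpair.1, hmem⟩
  · rintro ⟨_, ⟨s, rfl⟩, hs⟩
    exact ⟨s.pair k, by simpa using hs⟩

/-- The rational parametrization of the unit circle in the plane of the first two coordinates:
the line of slope `t` through `(-1, 0)` meets the circle again in `circlePoint n t`. -/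
noncomputable def circlePoint (n : ℕ) (t : ℝ) : EuclideanSpace ℝ (Fin n) :=
  WithLp.toLp 2 fun i =>
    if (i : ℕ) = 0 then (1 - t ^ 2) / (1 + t ^ 2)
    else if (i : ℕ) = 1 then 2 * t / (1 + t ^ 2) else 0

theorem continuous_circlePoint (n : ℕ) : Continuous (circlePoint n) := by
  refine (PiLp.continuous_toLp 2 _).comp (continuous_pi fun i => ?_)
  have hne (t : ℝ) : 1 + t ^ 2 ≠ 0 := by positivity
  split_ifs
  · exact Continuous.div (by fun_prop) (by fun_prop) hne
  · exact Continuous.div (by fun_prop) (by fun_prop) hne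
  · exact continuous_const

theorem circlePoint_zero (n : ℕ) (t : ℝ) :
    circlePoint (n + 2) t 0 = (1 - t ^ 2) / (1 + t ^ 2) := by
  simp [circlePoint]

theorem circlePoint_one (n : ℕ) (t : ℝ) : circlePoint (n + 2) t 1 = 2 * t / (1 + t ^ 2) := by
  simp [circlePoint]

theorem circlePoint_succ_succ {n : ℕ} (t : ℝ) (i : Fin n) :
    circlePoint (n + 2) t i.succ.succ = 0 := by
  simp [circlePoint]

theorem norm_circlePoint (n : ℕ) (t : ℝ) : ‖circlePoint (n + 2) t‖ = 1 := by
  rw [← sq_eq_sq₀ (norm_nonneg _) zero_le_one, EuclideanSpace.norm_sq_eq, Fin.sum_univ_succ,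
    Fin.sum_univ_succ, Fin.succ_zero_eq_one]
  simp only [circlePoint_zero, circlePoint_one, circlePoint_succ_succ, Real.norm_eq_abs, sq_abs,
    zero_pow two_ne_zero, Finset.sum_const_zero, add_zero]
  field_simp
  ring

theorem one_add_circlePoint_zero_pos (n : ℕ) (t : ℝ) : 0 < 1 + circlePoint (n + 2) t 0 := by
  have hzero : 1 + circlePoint (n + 2) t 0 = 2 / (1 + t ^ 2) := by
    rw [circlePoint_zero]
    field_simp
    ring
  rw [hzero]
  positivity

theorem circlePoint_one_eq_mul_one_add_zero (n : ℕ) (t : ℝ) :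
    circlePoint (n + 2) t 1 = t * (1 + circlePoint (n + 2) t 0) := by
  rw [circlePoint_zero, circlePoint_one]
  field_simp
  ring

/-- A sequence outside the unit circle that approaches it, and whose direction at stage `s` is
given by the parameter `t s`. -/
noncomputable def spiral (n : ℕ) (t : ℕ → ℝ) (s : ℕ) : EuclideanSpace ℝ (Fin n) :=
  (1 + (2⁻¹ : ℝ) ^ s) • circlePoint n (t s)

theorem norm_spiral (n : ℕ) (t : ℕ → ℝ) (s : ℕ) : ‖spiral (n + 2) t s‖ = 1 + 2⁻¹ ^ s := by
  rw [spiral, norm_smul, norm_circlePoint, mul_one, Real.norm_of_nonneg (by positivity)]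

theorem tendsto_half_pow : Tendsto (fun s : ℕ => (2⁻¹ : ℝ) ^ s) atTop (𝓝 0) :=
  tendsto_pow_atTop_nhds_zero_of_lt_one (by norm_num) (by norm_num)

theorem mapClusterPt_spiral_of_dist_eq_infDist {n : ℕ} {t : ℕ → ℝ}
    {y : EuclideanSpace ℝ (Fin (n + 2))} (hy : y ∈ closure (Set.range (spiral (n + 2) t)))
    (hmin : dist 0 y = Metric.infDist 0 (closure (Set.range (spiral (n + 2) t)))) :
    MapClusterPt y atTop (spiral (n + 2) t) := by
  have hle (s : ℕ) : ‖y‖ ≤ 1 + 2⁻¹ ^ s := by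
    rw [← norm_spiral n t s, ← dist_zero_left y, ← dist_zero_left, hmin]
    exact Metric.infDist_le_dist_of_mem (subset_closure (Set.mem_range_self s))
  have hy1 : ‖y‖ ≤ 1 := ge_of_tendsto' (by simpa using tendsto_half_pow.const_add 1) hle
  refine mapClusterPt_of_mem_closure_range hy fun s hs => ?_
  have hnorm : ‖y‖ = 1 + 2⁻¹ ^ s := hs ▸ norm_spiral n t s
  linarith [show (0 : ℝ) < 2⁻¹ ^ s by positivity]

theorem exists_circlePoint_eq_of_mapClusterPt_spiral {n : ℕ} {t : ℕ → ℝ}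
    (ht : IsCompact (closure (Set.range t))) {y : EuclideanSpace ℝ (Fin n)}
    (hy : MapClusterPt y atTop (spiral n t)) :
    ∃ T, MapClusterPt T atTop t ∧ circlePoint n T = y := by
  obtain ⟨φ, hφ, hφy⟩ := hy.tendsto_subseq
  obtain ⟨T, -, ψ, hψ, hT⟩ :=
    ht.tendsto_subseq fun s => subset_closure (Set.mem_range_self (φ s))
  have hφψ : Tendsto (φ ∘ ψ) atTop atTop := (hφ.comp hψ).tendsto_atTop
  refine ⟨T, hT.mapClusterPt.of_comp hφψ, ?_⟩
  have hlim : Tendsto (spiral n t ∘ φ ∘ ψ) atTop (𝓝 ((1 + 0 : ℝ) • circlePoint n T)) :=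
    ((tendsto_half_pow.comp hφψ).const_add 1).smul
      (((continuous_circlePoint n).tendsto T).comp hT)
  rw [add_zero, one_smul] at hlim
  exact tendsto_nhds_unique hlim (hφy.comp hψ.tendsto_atTop)

theorem exists_primrec₂_ratVecEnum_eq_smul_circlePoint (n : ℕ) :
    ∃ c : ℕ → ℕ → ℕ, Primrec₂ c ∧ ∀ s a,
      ratVecEnum n (c s a) = (1 + (2⁻¹ : ℝ) ^ s) • circlePoint n (ratEnum a) := by
  have hscale : PrimrecRat fun v : ℕ × ℕ => 1 + ((2 : ℕ) : ℚ)⁻¹ ^ v.1 :=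
    (PrimrecRat.const 1).add (.invPow 2 .fst)
  have hparam : PrimrecRat fun v : ℕ × ℕ => ratEnum v.2 := .ratEnum .snd
  have hden : PrimrecRat fun v : ℕ × ℕ => 1 + ratEnum v.2 ^ 2 := (PrimrecRat.const 1).add hparam.sq
  have hcoord (i : Fin n) : PrimrecRat fun v : ℕ × ℕ =>
      if (i : ℕ) = 0 then (1 - ratEnum v.2 ^ 2) / (1 + ratEnum v.2 ^ 2)
      else if (i : ℕ) = 1 then 2 * ratEnum v.2 / (1 + ratEnum v.2 ^ 2) else 0 := by
    split_ifs
    exacts [((PrimrecRat.const 1).sub hparam.sq).div hden,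
      ((PrimrecRat.const 2).mul hparam).div hden, .const 0]
  obtain ⟨c, hc, hcoord_eq⟩ := exists_primrec_ratVecEnum_eq fun i => hscale.mul (hcoord i)
  refine ⟨fun s a => c (s, a), hc, fun s a => ?_⟩
  ext i
  rw [hcoord_eq]
  simp [circlePoint, apply_ite (Rat.cast : ℚ → ℝ)]

theorem exists_recursiveFunctional_names_spiral (n : ℕ) :
    ∃ H : Baire → ℕ → ℕ, RecursiveFunctional (fun p k => Part.some (H p k)) ∧ ∀ p,
      (projPos n).source.Names (H p)
        (0, ⟨closure (Set.range (spiral n fun s => ratEnum (p (s.pair s)))),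
          isClosed_closure⟩) := by
  classical
  obtain ⟨o, -, ho⟩ := exists_primrec_ratVecEnum_eq (α := ℕ) fun _ : Fin n => .const 0
  obtain ⟨c, hc, hcspiral⟩ := exists_primrec₂_ratVecEnum_eq_smul_circlePoint n
  have hs : Primrec fun k : ℕ => (k / 2).unpair.1 :=
    Primrec.fst.comp (Primrec.unpair.comp (Primrec.nat_div.comp .id (.const 2)))
  have hball : Primrec fun k : ℕ => (k / 2).unpair.2 :=
    Primrec.snd.comp (Primrec.unpair.comp (Primrec.nat_div.comp .id (.const 2)))
  have hmem : PrimrecPred fun v : ℕ × ℕ => ratVecEnum n (c (v.1 / 2).unpair.1 v.2) ∈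
      basicBall (ratVecEnum n) (v.1 / 2).unpair.2 :=
    primrecPred_dist_ratVecEnum_lt n (hc.comp (hs.comp .fst) .snd)
      (Primrec.fst.comp (Primrec.unpair.comp (hball.comp .fst)))
      (.nonnegRatEnum (Primrec.snd.comp (Primrec.unpair.comp (hball.comp .fst))))
  have hentry : Primrec₂ fun k a : ℕ => if k % 2 = 0 then o 0 else
      if ratVecEnum n (c (k / 2).unpair.1 a) ∈ basicBall (ratVecEnum n) (k / 2).unpair.2
      then (k / 2).unpair.2 + 1 else 0 :=
    Primrec.ite (Primrec.eq.comp (Primrec.nat_mod.comp .fst (.const 2)) (.const 0)) (.const (o 0))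
      (Primrec.ite hmem (Primrec.succ.comp (hball.comp .fst)) (.const 0))
  refine ⟨_, .query (Primrec₂.natPair.comp hs hs).to_comp hentry.to_comp, fun p => ⟨?_, ?_⟩⟩
  · have hzero : ratVecEnum n (o 0) = 0 := by
      ext i
      simp [ho]
    have hnames := BaireRep.cauchy_names_const _ (denseRange_ratVecEnum n) (o 0)
    simpa [hzero] using! hnames
  · have hspiral : (ratVecEnum n ∘ fun s => c s (p (s.pair s))) =
        spiral n fun s => ratEnum (p (s.pair s)) := funext fun s => hcspiral s _
    have hodd (i : ℕ) : (2 * i + 1) / 2 = i := by omega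
    have hnames := BaireRep.positive_names_closure_range (denseRange_ratVecEnum n)
      fun s => c s (p (s.pair s))
    simpa [hodd, ← hspiral] using! hnames

theorem abs_div_one_add_sub_lt {x y X T δ η : ℝ} (hx : |x - X| ≤ δ) (hy : |y - T * (1 + X)| ≤ δ)
    (hη : 0 < η) (h : (1 + |y / (1 + x)|) * δ < η * (1 + x - δ)) : |y / (1 + x) - T| < η := by
  have hδ : 0 ≤ δ := (abs_nonneg _).trans hx
  have hgap : 0 < 1 + x - δ := by
    have hpos : 0 < η * (1 + x - δ) := lt_of_le_of_lt (by positivity) h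
    exact (pos_iff_pos_of_mul_pos hpos).1 hη
  have hX : 1 + x - δ ≤ 1 + X := by linarith [le_of_abs_le hx]
  have hpos : 0 < 1 + X := hgap.trans_le hX
  set t := y / (1 + x) with ht
  have hty : y = t * (1 + x) := by rw [ht, div_mul_cancel₀]; linarith
  refine lt_of_mul_lt_mul_right ?_ hpos.le
  calc |t - T| * (1 + X) = |(y - T * (1 + X)) - t * (x - X)| := by
        rw [← abs_of_pos hpos, ← abs_mul, abs_of_pos hpos, hty]; congr 1; ring
    _ ≤ |y - T * (1 + X)| + |t| * |x - X| := (abs_sub _ _).trans_eq (by rw [abs_mul])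
    _ ≤ δ + |t| * δ := by gcongr
    _ = (1 + |t|) * δ := by ring
    _ < η * (1 + x - δ) := h
    _ ≤ η * (1 + X) := by gcongr

theorem exists_slope_error_lt {x y : ℕ → ℝ} {X Y η : ℝ} (hX : 0 < 1 + X) (hη : 0 < η)
    (hx : ∀ m, |x m - X| ≤ 2⁻¹ ^ m) (hy : ∀ m, |y m - Y| ≤ 2⁻¹ ^ m) :
    ∃ m, (1 + |y m / (1 + x m)|) * 2⁻¹ ^ m < η * (1 + x m - 2⁻¹ ^ m) := by
  have hxlim : Tendsto x atTop (𝓝 X) :=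
    tendsto_iff_dist_tendsto_zero.2 (squeeze_zero (fun _ => dist_nonneg) hx tendsto_half_pow)
  have hylim : Tendsto y atTop (𝓝 Y) :=
    tendsto_iff_dist_tendsto_zero.2 (squeeze_zero (fun _ => dist_nonneg) hy tendsto_half_pow)
  have hslope : Tendsto (fun m => (1 + |y m / (1 + x m)|) * (2⁻¹ : ℝ) ^ m) atTop
      (𝓝 ((1 + |Y / (1 + X)|) * 0)) :=
    ((hylim.div (hxlim.const_add 1) hX.ne').abs.const_add 1).mul tendsto_half_pow
  have hgap : Tendsto (fun m => η * (1 + x m - (2⁻¹ : ℝ) ^ m)) atTop (𝓝 (η * (1 + X - 0))) :=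
    ((hxlim.const_add 1).sub tendsto_half_pow).const_mul η
  exact (hslope.eventually_lt hgap (by rw [mul_zero, sub_zero]; exact mul_pos hη hX)).exists

theorem exists_recursiveFunctional_circleParam (n : ℕ) :
    ∃ Φ, RecursiveFunctional Φ ∧ ∀ r T, (euclideanRep (n + 2)).Names r (circlePoint (n + 2) T) →
      ∃ q : Baire, (∀ i, q i ∈ Φ r i) ∧ realRep.Names q T := by
  obtain ⟨x, hx, hx_eq⟩ := exists_primrecRat_eq_ratVecEnum_apply (0 : Fin (n + 2))
  obtain ⟨y, hy, hy_eq⟩ := exists_primrecRat_eq_ratVecEnum_apply (1 : Fin (n + 2))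
  have hentry : Primrec fun v : ℕ × ℕ × ℕ => v.2.2 := Primrec.snd.comp .snd
  have hgap := (PrimrecRat.const 1).add (hx.comp hentry)
  have hslope := (hy.comp hentry).div hgap
  have hδ : PrimrecRat fun v : ℕ × ℕ × ℕ => ((2 : ℕ) : ℚ)⁻¹ ^ v.2.1 :=
    .invPow 2 (Primrec.fst.comp .snd)
  have hη : PrimrecRat fun v : ℕ × ℕ × ℕ => ((2 : ℕ) : ℚ)⁻¹ ^ (v.1 + 1) :=
    .invPow 2 (Primrec.succ.comp .fst)
  have htest := (((PrimrecRat.const 1).add hslope.abs).mul hδ).lt (hη.mul (hgap.sub hδ))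
  obtain ⟨g, hg, hg_eq⟩ := hslope
  obtain ⟨Φ, hΦ, hsearch⟩ := RecursiveFunctional.exists_search .id (R := fun i m k =>
    (1 + |y k / (1 + x k)|) * ((2 : ℕ) : ℚ)⁻¹ ^ m <
      ((2 : ℕ) : ℚ)⁻¹ ^ (i + 1) * (1 + x k - ((2 : ℕ) : ℚ)⁻¹ ^ m)) htest hg.to_comp
  refine ⟨Φ, hΦ, fun r T hr => ?_⟩
  have hX := one_add_circlePoint_zero_pos n T
  set X := circlePoint (n + 2) T 0 with hXdef
  have hxr (m : ℕ) : |x (r m) - X| ≤ 2⁻¹ ^ m := by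
    rw [← hx_eq]
    exact (PiLp.dist_apply_le _ _ 0).trans (BaireRep.cauchy_dist_le hr m)
  have hyr (m : ℕ) : |y (r m) - T * (1 + X)| ≤ 2⁻¹ ^ m := by
    rw [← hy_eq, hXdef, ← circlePoint_one_eq_mul_one_add_zero]
    exact (PiLp.dist_apply_le _ _ 1).trans (BaireRep.cauchy_dist_le hr m)
  have happrox (i : ℕ) : ∃ a ∈ Φ r i, |(ratEnum a : ℝ) - T| < 2⁻¹ ^ (i + 1) := by
    obtain ⟨m, hm, hgm⟩ := hsearch r i <| by
      obtain ⟨m, hm⟩ := exists_slope_error_lt (η := 2⁻¹ ^ (i + 1)) hX (by positivity) hxr hyr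
      refine ⟨m, (Rat.cast_lt (K := ℝ)).1 ?_⟩
      push_cast
      exact hm
    rw [← Rat.cast_lt (K := ℝ)] at hm
    push_cast at hm
    refine ⟨_, hgm, ?_⟩
    rw [hg_eq]
    push_cast
    exact abs_div_one_add_sub_lt (hxr m) (hyr m) (by positivity) hm
  choose q hqΦ hq using happrox
  exact ⟨q, hqΦ, BaireRep.cauchy_names_of_dist_le fun i => (hq i).le⟩

theorem bwtReal_strongReducible_projPos {n : ℕ} (hn : 2 ≤ n) :
    bwtReal.StrongReducible (projPos n) := by
  obtain ⟨n, rfl⟩ := Nat.exists_eq_add_of_le' hn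
  obtain ⟨H, hH, hspiral⟩ := exists_recursiveFunctional_names_spiral (n + 2)
  obtain ⟨Φ, hΦ, hparam⟩ := exists_recursiveFunctional_circleParam n
  refine .of_functional hH hΦ fun p a hp ha => ?_
  have ha := (mem_dom_bwt_iff (δ := realRep)).1 ha
  set t : ℕ → ℝ := fun s => ratEnum (p (s.pair s))
  have hta (s : ℕ) : dist (t s) (a s) ≤ 2⁻¹ ^ s := BaireRep.cauchy_dist_le (hp s) s
  have ht : IsCompact (closure (Set.range t)) := by
    refine (ha.cthickening (r := 1)).closure_of_subset ?_
    rintro _ ⟨s, rfl⟩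
    exact Metric.mem_cthickening_of_dist_le _ (a s) _ _ (subset_closure (Set.mem_range_self s))
      ((hta s).trans (pow_le_one₀ (by norm_num) (by norm_num)))
  have hta0 : Tendsto (fun s => dist (t s) (a s)) atTop (𝓝 0) :=
    squeeze_zero (fun _ => dist_nonneg) hta tendsto_half_pow
  obtain ⟨y, hy, hmin⟩ := isClosed_closure.exists_infDist_eq_dist
    (Set.range_nonempty (spiral (n + 2) t)).closure 0
  refine ⟨(0, ⟨closure (Set.range (spiral (n + 2) t)), isClosed_closure⟩), ⟨y, hy, hmin.symm⟩,
    hspiral p, ?_⟩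
  rintro y ⟨hy, hmin⟩ r hr
  obtain ⟨T, hT, rfl⟩ := exists_circlePoint_eq_of_mapClusterPt_spiral ht
    (mapClusterPt_spiral_of_dist_eq_infDist hy hmin)
  obtain ⟨q, hqΦ, hqT⟩ := hparam r T hr
  exact ⟨q, T, hqΦ, ⟨ha, mapClusterPt_of_tendsto_dist_zero hT hta0⟩, hqT⟩

theorem computablePred_dist_ratVecEnum_lt_pow (n : ℕ) :
    ComputablePred fun v : (ℕ × ℕ) × ℕ =>
      dist (ratVecEnum n v.2) (ratVecEnum n v.1.2) < 2⁻¹ ^ v.1.1 := by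
  refine (primrecPred_dist_ratVecEnum_lt n .snd (Primrec.snd.comp .fst)
    (.invPow 2 (Primrec.fst.comp .fst))).of_eq (fun v => ?_) |>.computablePred
  push_cast
  rfl

theorem mainTheorem3 (n : ℕ) (hn : 2 ≤ n) :
    MultiFunction.StrongEquiv (projPos n) bwtReal :=
  ⟨(projPos_strongReducible_bwt_euclideanRep n).trans
    ((bwt_cauchy_strongReducible_bwt_baireRep (denseRange_ratVecEnum n)
      (computablePred_dist_ratVecEnum_lt_pow n)).trans bwt_baireRep_strongReducible_bwtReal),
    bwtReal_strongReducible_projPos hn⟩
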